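/- Let $n\ge 2$. For $s\in\mathbb R$ let $H_s(\mathbb R^n)$ be the Sobolev space of tempered distributions $f$ with $\int_{\mathbb R^n}(1+|\xi|^2)^s|\widehat f(\xi)|^2\,d\xi<\infty$. For $f\in L^1(\mathbb R^n)$ and $t>0$ put $$S_tf(x)=(K_t\star f)(x)=\int_{\mathbb R^n}K_t(x-y)f(y)\,dy,\qquad K_t(x)=\int_{\mathbb R^n} e^{-i\xi\cdot x}e^{it|\xi|^2}\,d\xi=\Big(\frac{\pi}{t}\Big)^{n/2}e^{i\pi n/4}e^{-i|x|^2/(4t)},$$ the integral defining $K_t$ being understood as the Fourier transform of a tempered distribution (so that $S_tf(x)=\int e^{i\xi\cdot x}e^{it|\xi|^2}\widehat f(\xi)\,d\xi$ for Schwartz functions $f$, where $\widehat f(\xi)=\int e^{-i\xi\cdot x}f(x)\,dx$). Then there are a function $f\in L^1(\mathbb R^n)$ that belongs to $H_s(\mathbb R^n)$ for every $s<\frac{n}{2(n+1)}$, a measurable set $F\subset\mathbb R^n\setminus\operatorname{supp}f$ of positive Lebesgue measure and a constant $c_0>0$ such that for every $x\in F$ there is a sequence of times $t_j>0$ (depending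 on $x$) with $t_j\to0$ and $|S_{t_j}f(x)|\ge c_0$ for all $j$; in particular, for no $x\in F$ does $S_tf(x)$ tend to $0$ as $t\to0^+$. Consequently, for every $s<\frac{n}{2(n+1)}$ localization almost everywhere fails for $H_s(\mathbb R^n)$, already among integrable functions: it is not true that for every $f\in H_s(\mathbb R^n)\cap L^1(\mathbb R^n)$ one has $\lim_{t\to0^+}S_tf(x)=0$ for almost every $x\in\mathbb R^n\setminus\operatorname{supp}f$. -/

import Mathlib

open MeasureTheory Filter Topology TemperedDistribution

noncomputable section

/-- The membership `f ∈ H_s(ℝⁿ) ∩ L¹(ℝⁿ)` for a function `f : ℝⁿ → ℂ`: `f` is integrable, and the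
tempered distribution that it represents lies in the Sobolev space `H_s`, i.e.
`(1 + |ξ|²)^(s/2) f̂(ξ)` is square integrable (the space does not depend on the normalization of
the Fourier transform). -/
def MemSobolevL1 (n : ℕ) (s : ℝ) (f : EuclideanSpace ℝ (Fin n) → ℂ) : Prop :=
  ∃ hf : MemLp f 1 (volume : Measure (EuclideanSpace ℝ (Fin n))),
    MemSobolev s 2 (Lp.toTemperedDistribution (hf.toLp f))

/-- The kernel `K_t(x) = t^(-n/2) K(x / t^(1/2))`, `t > 0`, where
`K(x) = (π^(1/2) e^(iπ/4))^n e^(-i|x|²/4)` is the Fourier transform of `e^(i|ξ|²)`.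
Thus `K_t` is the Fourier transform `∫ e^(-i x·ξ) e^(it|ξ|²) dξ` of `e^(it|ξ|²)`. -/
def schrodingerKernel (n : ℕ) (t : ℝ) (x : EuclideanSpace ℝ (Fin n)) : ℂ :=
  ((t ^ (-(n : ℝ) / 2) : ℝ) : ℂ) *
    ((((Real.sqrt Real.pi : ℝ) : ℂ) * Complex.exp (Complex.I * Real.pi / 4)) ^ n *
      Complex.exp (-Complex.I * ((‖x‖ ^ 2 / (4 * t) : ℝ) : ℂ)))

/-- The Schrödinger mean `S_t f(x) = (K_t ⋆ f)(x)` of `f ∈ L¹(ℝⁿ)` at time `t > 0`. -/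
def schrodingerMean (n : ℕ) (f : EuclideanSpace ℝ (Fin n) → ℂ) (t : ℝ)
    (x : EuclideanSpace ℝ (Fin n)) : ℂ :=
  ∫ y, schrodingerKernel n t (x - y) * f y

/-- Localization almost everywhere at regularity `s`, for those functions of `H_s(ℝⁿ)` that are
integrable: `S_t f(x) → 0` as `t → 0+` for almost every `x` outside the support of `f`. As only
integrable functions are tested, this is implied by localization on all of `H_s(ℝⁿ)`, so that its
failure is the stronger assertion. -/
def LocalizationAE (n : ℕ) (s : ℝ) : Prop :=
  ∀ f : EuclideanSpace ℝ (Fin n) → ℂ, MemSobolevL1 n s f →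
    ∀ᵐ x : EuclideanSpace ℝ (Fin n), x ∉ tsupport f →
      Tendsto (fun t : ℝ => schrodingerMean n f t x) (𝓝[>] 0) (𝓝 0)

end

/-!
Localization fails because of an explicit function that is a superposition of *blocks*, one for each
of a rapidly increasing sequence of integers `N`. Write `n = d + 1`, `σ = N ^ (d + 2)` and
`D = 32 ^ d * N ^ (2 d + 3)`, so that `D N` is of the order `σ²`. A block is a tensor product
(`block`); in the first coordinate it is the plane wave `e^(-iσ²y)` cut off to an interval
`[0, 1/(4σ)]` (`cutWave`), and in each of the other `d` coordinates it is the average of `N` Gaussian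
wave packets with frequencies `θ_j, D + θ_j, …, (N - 1) D + θ_j` (`waveSum`).

The Schrödinger kernel is a tensor product, so everything reduces to the line. The plane wave in the
first coordinate has velocity `2σ²`: although it starts near `0`, it arrives at `x₀ ∈ (1/2, 1)` at
the time `t ≈ x₀ / (2σ²)`, where it is bounded below during a time of the order `σ⁻³`
(`le_norm_schrodingerMeanLine_cutWave`). The evolution of the wave packets is known in closed form.
At a time `t = 2πm / D²` the quadratic phases `t D² l²` are trivial, and the packets are in phase at
`x_j` if `D x_j + 2 t D θ_j` is within `O(1/N)` of a multiple of `2π`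
(`le_norm_schrodingerMeanLine_waveSum`). With `θ_j = D / (2 (16N)^(j+1))` this is a condition on one
digit of `m` in base `16N`, and the `d` digits can be prescribed within any `(16N)^d` consecutive
integers `m` (`exists_int_digits`). The spacing `D` is just large enough that so many admissible times
occur while the first wave passes (`exists_focusing_time`). Thus every block is bounded below at
every point of a fixed cube away from its support, at a time of the order `σ⁻²`
(`exists_le_norm_schrodingerMean_block`).

On the other hand the block has frequencies `O(σ²)`, and its squared `L²` norm is
`O(σ⁻¹ N⁻ᵈ) = O(N ^ (-2 (d + 1)))`, by the separation of the frequencies `D l + θ_j`. Hence its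
`H_s` norm is `O(N ^ ((2 d + 4) s - (d + 1)))` (`exists_eLpNorm_block_le`), which decays exactly for
`s < n / (2 (n + 1))`. At the time selected for one block, the earlier blocks contribute little by an
integration by parts, as the point is off their support (`exists_norm_schrodingerMeanLine_le`), and
the later ones by the dispersive estimate, as their `L¹` norms are tiny (`norm_schrodingerMean_le`);
see `exists_blockSeries_le_norm_schrodingerMean`.
-/

open scoped FourierTransform SchwartzMap ENNReal ContDiff

/-! ### Sobolev norms of integrable functions -/

/-- For an integrable function the distributional Fourier transform is given by the Fourier
integral, so that membership in `H_s` is a weighted `L²` condition on the latter. -/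
lemma memSobolevL1_of_memLp_fourier {n : ℕ} {s : ℝ} {f : EuclideanSpace ℝ (Fin n) → ℂ}
    (hf : Integrable f)
    (h : MemLp (fun ξ => (((1 + ‖ξ‖ ^ 2) ^ (s / 2) : ℝ) : ℂ) * 𝓕 f ξ) 2) :
    MemSobolevL1 n s f := by
  have hf1 : MemLp f 1 (volume : Measure (EuclideanSpace ℝ (Fin n))) :=
    memLp_one_iff_integrable.2 hf
  refine ⟨hf1, memSobolev_iff_exists_smulLeftCLM_fourier.2 ⟨h.toLp _, ?_⟩⟩
  ext φ
  have hg : (fun ξ : EuclideanSpace ℝ (Fin n) =>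
      (((1 + ‖ξ‖ ^ 2) ^ (s / 2) : ℝ) : ℂ)).HasTemperateGrowth := by fun_prop
  rw [TemperedDistribution.smulLeftCLM_apply_apply, TemperedDistribution.fourier_apply,
    Lp.toTemperedDistribution_apply, Lp.toTemperedDistribution_apply]
  set ψ : 𝓢(EuclideanSpace ℝ (Fin n), ℂ) := SchwartzMap.smulLeftCLM ℂ
    (fun ξ : EuclideanSpace ℝ (Fin n) => (((1 + ‖ξ‖ ^ 2) ^ (s / 2) : ℝ) : ℂ)) φ with hψ
  have hψa : ∀ x, ψ x = (((1 + ‖x‖ ^ 2) ^ (s / 2) : ℝ) : ℂ) * φ x := fun x => by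
    rw [hψ, SchwartzMap.smulLeftCLM_apply_apply hg, smul_eq_mul]
  have key := VectorFourier.integral_fourierIntegral_smul_eq_flip
    (e := Real.fourierChar) (μ := (volume : Measure (EuclideanSpace ℝ (Fin n))))
    (ν := (volume : Measure (EuclideanSpace ℝ (Fin n))))
    (L := innerₗ (EuclideanSpace ℝ (Fin n)))
    Real.continuous_fourierChar continuous_inner ψ.integrable hf
  calc ∫ x, (𝓕 ψ) x • (hf1.toLp f) x = ∫ x, (𝓕 (ψ : EuclideanSpace ℝ (Fin n) → ℂ) x) • f x := by
        refine integral_congr_ae ?_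
        filter_upwards [hf1.coeFn_toLp] with x hx
        rw [hx, SchwartzMap.fourier_coe]
    _ = ∫ x, ψ x • 𝓕 f x := by
        rw [flip_innerₗ] at key
        exact key
    _ = _ := by
        refine integral_congr_ae ?_
        filter_upwards [h.coeFn_toLp] with x hx
        rw [hx, hψa]
        simp only [smul_eq_mul]
        ring

/-- The triangle inequality for infinite sums in `Lᵖ`. -/
lemma memLp_of_hasSum {α E : Type*} [MeasurableSpace α] [NormedAddCommGroup E] {μ : Measure α}
    {p : ℝ≥0∞} (hp : 1 ≤ p) {g : ℕ → α → E} {G : α → E} {a : ℕ → ℝ}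
    (hg : ∀ k, AEStronglyMeasurable (g k) μ) (hG : ∀ᵐ x ∂μ, HasSum (fun k => g k x) (G x))
    (ha0 : ∀ k, 0 ≤ a k) (ha : Summable a) (hga : ∀ k, eLpNorm (g k) p μ ≤ ENNReal.ofReal (a k)) :
    MemLp G p μ := by
  have hlim : ∀ᵐ x ∂μ, Tendsto (fun m => (∑ k ∈ Finset.range m, g k) x) atTop (𝓝 (G x)) := by
    filter_upwards [hG] with x hx
    simpa using hx.tendsto_sum_nat
  have hmeas : ∀ m, AEStronglyMeasurable (∑ k ∈ Finset.range m, g k) μ := fun m =>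
    Finset.aestronglyMeasurable_sum _ fun k _ => hg k
  refine ⟨aestronglyMeasurable_of_tendsto_ae atTop hmeas hlim, ?_⟩
  refine lt_of_le_of_lt (Lp.eLpNorm_lim_le_liminf_eLpNorm hmeas G hlim) ?_
  refine lt_of_le_of_lt (?_ : _ ≤ ENNReal.ofReal (∑' k, a k)) ENNReal.ofReal_lt_top
  refine liminf_le_of_le (by isBoundedDefault) fun b hb => ?_
  obtain ⟨m, hm⟩ := hb.exists
  refine hm.trans ((eLpNorm_sum_le (fun k _ => hg k) hp).trans ?_)
  refine (Finset.sum_le_sum fun k _ => hga k).trans ?_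
  rw [← ENNReal.ofReal_sum_of_nonneg fun k _ => ha0 k]
  exact ENNReal.ofReal_le_ofReal (ha.sum_le_tsum _ fun k _ => ha0 k)

/-! ### Tensor products -/

lemma integral_euclidean_prod {n : ℕ} {𝕜 : Type*} [RCLike 𝕜] (f : Fin n → ℝ → 𝕜) :
    ∫ x : EuclideanSpace ℝ (Fin n), ∏ i, f i (x i) = ∏ i, ∫ y, f i y := by
  rw [← (PiLp.volume_preserving_toLp (Fin n)).integral_comp
    (MeasurableEquiv.toLp 2 (Fin n → ℝ)).measurableEmbedding]
  exact integral_fintype_prod_volume_eq_prod f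

lemma integrable_euclidean_prod {n : ℕ} {𝕜 : Type*} [RCLike 𝕜] {f : Fin n → ℝ → 𝕜}
    (hf : ∀ i, Integrable (f i)) :
    Integrable fun x : EuclideanSpace ℝ (Fin n) => ∏ i, f i (x i) := by
  rw [← (PiLp.volume_preserving_toLp (Fin n)).integrable_comp_emb
    (MeasurableEquiv.toLp 2 (Fin n → ℝ)).measurableEmbedding]
  exact Integrable.fintype_prod hf

lemma fourier_euclidean_prod {n : ℕ} (f : Fin n → ℝ → ℂ) (ξ : EuclideanSpace ℝ (Fin n)) :
    𝓕 (fun x : EuclideanSpace ℝ (Fin n) => ∏ i, f i (x i)) ξ = ∏ i, 𝓕 (f i) (ξ i) := by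
  simp_rw [Real.fourier_eq', ← integral_euclidean_prod]
  congr 1 with x
  simp only [smul_eq_mul, Finset.prod_mul_distrib, ← Complex.exp_sum]
  congr 2
  simp [PiLp.inner_apply, Finset.mul_sum, Finset.sum_mul]

/-- The one-dimensional kernel whose `n`-fold tensor power is `schrodingerKernel n t`. -/
noncomputable def schrodingerKernelLine (t x : ℝ) : ℂ :=
  ((t ^ (-(1 : ℝ) / 2) : ℝ) : ℂ) *
    ((((Real.sqrt Real.pi : ℝ) : ℂ) * Complex.exp (Complex.I * Real.pi / 4)) *
      Complex.exp (-Complex.I * ((x ^ 2 / (4 * t) : ℝ) : ℂ)))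

/-- The Schrödinger mean of a function on the line. -/
noncomputable def schrodingerMeanLine (f : ℝ → ℂ) (t x : ℝ) : ℂ :=
  ∫ y, schrodingerKernelLine t (x - y) * f y

lemma schrodingerKernel_eq_prod {n : ℕ} {t : ℝ} (ht : 0 < t) (x : EuclideanSpace ℝ (Fin n)) :
    schrodingerKernel n t x = ∏ i, schrodingerKernelLine t (x i) := by
  simp only [schrodingerKernel, schrodingerKernelLine, Finset.prod_mul_distrib, Finset.prod_const,
    Finset.card_univ, Fintype.card_fin, ← Complex.exp_sum, ← Finset.mul_sum]
  congr 2
  · rw [← Complex.ofReal_pow, ← Real.rpow_natCast, ← Real.rpow_mul ht.le]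
    congr 2
    ring
  · exact mul_pow _ _ _
  · rw [EuclideanSpace.norm_sq_eq, Finset.sum_div]
    simp

lemma schrodingerMean_prod {n : ℕ} {t : ℝ} (ht : 0 < t) (f : Fin n → ℝ → ℂ)
    (x : EuclideanSpace ℝ (Fin n)) :
    schrodingerMean n (fun y => ∏ i, f i (y i)) t x = ∏ i, schrodingerMeanLine (f i) t (x i) := by
  simp only [schrodingerMean, schrodingerMeanLine, ← integral_euclidean_prod,
    schrodingerKernel_eq_prod ht, ← Finset.prod_mul_distrib]
  rfl

lemma norm_schrodingerKernelLine {t : ℝ} (ht : 0 < t) (x : ℝ) :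
    ‖schrodingerKernelLine t x‖ = t ^ (-(1 : ℝ) / 2) * √Real.pi := by
  have h1 : ‖Complex.exp (Complex.I * Real.pi / 4)‖ = 1 := by
    rw [show Complex.I * Real.pi / 4 = ((Real.pi / 4 : ℝ) : ℂ) * Complex.I by push_cast; ring,
      Complex.norm_exp_ofReal_mul_I]
  have h2 : ‖Complex.exp (-Complex.I * ((x ^ 2 / (4 * t) : ℝ) : ℂ))‖ = 1 := by
    rw [show -Complex.I * ((x ^ 2 / (4 * t) : ℝ) : ℂ) = ((-(x ^ 2 / (4 * t)) : ℝ) : ℂ) * Complex.I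
      by push_cast; ring, Complex.norm_exp_ofReal_mul_I]
  rw [schrodingerKernelLine, norm_mul, norm_mul, norm_mul, h1, h2, Complex.norm_real,
    Complex.norm_real, Real.norm_of_nonneg (by positivity), Real.norm_of_nonneg (by positivity)]
  ring

lemma norm_schrodingerKernel {n : ℕ} {t : ℝ} (ht : 0 < t) (x : EuclideanSpace ℝ (Fin n)) :
    ‖schrodingerKernel n t x‖ = (t ^ (-(1 : ℝ) / 2) * √Real.pi) ^ n := by
  simp [schrodingerKernel_eq_prod ht, norm_prod, norm_schrodingerKernelLine ht]

lemma continuous_schrodingerKernel (n : ℕ) (t : ℝ) : Continuous (schrodingerKernel n t) := by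
  unfold schrodingerKernel
  fun_prop

lemma integrable_schrodingerKernel_mul {n : ℕ} {t : ℝ} (ht : 0 < t)
    {f : EuclideanSpace ℝ (Fin n) → ℂ} (hf : Integrable f) (x : EuclideanSpace ℝ (Fin n)) :
    Integrable fun y => schrodingerKernel n t (x - y) * f y := by
  refine hf.bdd_mul (c := (t ^ (-(1 : ℝ) / 2) * √Real.pi) ^ n) ?_ ?_
  · exact ((continuous_schrodingerKernel n t).comp (by fun_prop)).aestronglyMeasurable
  · exact Eventually.of_forall fun y => (norm_schrodingerKernel ht _).le

/-- The dispersive estimate. -/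
lemma norm_schrodingerMean_le {n : ℕ} {t : ℝ} (ht : 0 < t)
    (f : EuclideanSpace ℝ (Fin n) → ℂ) (x : EuclideanSpace ℝ (Fin n)) :
    ‖schrodingerMean n f t x‖ ≤ (t ^ (-(1 : ℝ) / 2) * √Real.pi) ^ n * ∫ y, ‖f y‖ := by
  rw [← integral_const_mul]
  refine (norm_integral_le_integral_norm _).trans (le_of_eq ?_)
  simp only [norm_mul, norm_schrodingerKernel ht]

lemma schrodingerMean_hasSum {n : ℕ} {t : ℝ} (ht : 0 < t)
    {f : ℕ → EuclideanSpace ℝ (Fin n) → ℂ} (hf : ∀ k, Integrable (f k))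
    (hs : Summable fun k => ∫ y, ‖f k y‖) (x : EuclideanSpace ℝ (Fin n)) :
    HasSum (fun k => schrodingerMean n (f k) t x)
      (schrodingerMean n (fun y => ∑' k, f k y) t x) := by
  have := hasSum_integral_of_summable_integral_norm
    (F := fun k y => schrodingerKernel n t (x - y) * f k y)
    (fun k => integrable_schrodingerKernel_mul ht (hf k) x) (by
      simp only [norm_mul, norm_schrodingerKernel ht, integral_const_mul]
      exact hs.mul_left _)
  simp only [tsum_mul_left] at this
  exact this

lemma fourier_hasSum {n : ℕ} {f : ℕ → EuclideanSpace ℝ (Fin n) → ℂ} (hf : ∀ k, Integrable (f k))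
    (hs : Summable fun k => ∫ y, ‖f k y‖) (ξ : EuclideanSpace ℝ (Fin n)) :
    HasSum (fun k => 𝓕 (f k) ξ) (𝓕 (fun y => ∑' k, f k y) ξ) := by
  have := hasSum_integral_of_summable_integral_norm
    (F := fun k y => (Real.fourierChar (-(inner ℝ y ξ)) : ℂ) * f k y)
    (fun k => by
      simpa [Circle.smul_def] using (Real.fourierIntegral_convergent_iff ξ).2 (hf k))
    (by simpa only [norm_mul, Circle.norm_coe, one_mul] using hs)
  simpa only [tsum_mul_left, Real.fourier_eq, Circle.smul_def, smul_eq_mul] using this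

/-! ### Gaussian wave packets on the line -/

/-- The Gaussian wave packet of frequency `ξ` on the line. -/
noncomputable def gaussianWave (ξ y : ℝ) : ℂ :=
  Complex.exp (-1 * (y : ℂ) ^ 2 + Complex.I * ξ * y + 0)

lemma integrable_gaussianWave (ξ : ℝ) : Integrable (gaussianWave ξ) :=
  integrable_cexp_quadratic (b := 1) (by simp) _ _

lemma norm_gaussianWave (ξ y : ℝ) : ‖gaussianWave ξ y‖ = Real.exp (-1 * y ^ 2) := by
  rw [gaussianWave, Complex.norm_exp]
  congr 1
  simp [← Complex.ofReal_pow]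

lemma integral_norm_gaussianWave (ξ : ℝ) : ∫ y, ‖gaussianWave ξ y‖ = √Real.pi := by
  simp only [norm_gaussianWave, integral_gaussian, div_one]

lemma fourier_gaussianWave (ξ η : ℝ) :
    𝓕 (gaussianWave ξ) η = (Real.pi : ℂ) ^ (1 / 2 : ℂ) *
      Complex.exp ((-(ξ - 2 * Real.pi * η) ^ 2 / 4 : ℝ) : ℂ) := by
  have h := integral_cexp_quadratic (b := -1) (by simp) (Complex.I * (ξ - 2 * Real.pi * η)) 0
  rw [Real.fourier_real_eq_integral_exp_smul]
  refine Eq.trans ?_ (h.trans ?_)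
  · congr 1 with y
    rw [gaussianWave, smul_eq_mul, ← Complex.exp_add]
    congr 1
    push_cast
    ring
  · rw [neg_neg, div_one]
    congr 2
    push_cast
    linear_combination (-(ξ - 2 * Real.pi * η : ℂ) ^ 2 / 4) * (-Complex.I_sq)

/-- The amplitude of the Schrödinger evolution of a Gaussian wave packet. -/
noncomputable def gaussianAmplitude (t : ℝ) : ℂ :=
  ((t ^ (-(1 : ℝ) / 2) : ℝ) : ℂ) *
    (((Real.sqrt Real.pi : ℝ) : ℂ) * Complex.exp (Complex.I * Real.pi / 4)) *
      (Real.pi / (1 + Complex.I / (4 * t))) ^ (1 / 2 : ℂ)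

/-- The evolution of a Gaussian wave packet in closed form: it travels with velocity `-2ξ`. -/
lemma schrodingerMeanLine_gaussianWave {t : ℝ} (ht : 0 < t) (ξ x : ℝ) :
    schrodingerMeanLine (gaussianWave ξ) t x = gaussianAmplitude t *
      Complex.exp (((-(x + 2 * t * ξ) ^ 2 / (1 + 16 * t ^ 2) : ℝ) : ℂ) +
        ((x * ξ + t * ξ ^ 2 - 4 * t * (x + 2 * t * ξ) ^ 2 / (1 + 16 * t ^ 2) : ℝ) : ℂ) *
          Complex.I) := by
  have ht' : (t : ℂ) ≠ 0 := by exact_mod_cast ht.ne'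
  have h1 : (1 + 16 * (t : ℂ) ^ 2) ≠ 0 := by
    have : (1 + 16 * t ^ 2 : ℝ) ≠ 0 := by positivity
    exact_mod_cast this
  have hre : (1 + Complex.I / (4 * t)).re = 1 := by
    rw [show Complex.I / (4 * t) = ((1 / (4 * t) : ℝ) : ℂ) * Complex.I by push_cast; field_simp]
    simp only [Complex.add_re, Complex.one_re, Complex.re_ofReal_mul, Complex.I_re, mul_zero,
      add_zero]
  have h := integral_cexp_quadratic (b := -(1 + Complex.I / (4 * t)))
    (by rw [Complex.neg_re, hre]; norm_num)
    (Complex.I * (x / (2 * t) + ξ)) (-Complex.I * (x ^ 2 / (4 * t)))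
  have hsplit : schrodingerMeanLine (gaussianWave ξ) t x = ((t ^ (-(1 : ℝ) / 2) : ℝ) : ℂ) *
    (((Real.sqrt Real.pi : ℝ) : ℂ) * Complex.exp (Complex.I * Real.pi / 4)) *
      ∫ y : ℝ, Complex.exp (-(1 + Complex.I / (4 * t)) * (y : ℂ) ^ 2 +
        Complex.I * (x / (2 * t) + ξ) * y + -Complex.I * (x ^ 2 / (4 * t))) := by
    rw [schrodingerMeanLine, ← integral_const_mul]
    congr 1 with y
    have hassoc : ∀ a b c d : ℂ, a * (b * c) * d = a * b * (c * d) := fun a b c d => by ring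
    rw [schrodingerKernelLine, gaussianWave, hassoc, ← Complex.exp_add]
    congr 2
    push_cast
    field_simp
    ring
  rw [hsplit, h, neg_neg, gaussianAmplitude]
  rw [mul_assoc _ ((Real.pi / (1 + Complex.I / (4 * t)) : ℂ) ^ (1 / 2 : ℂ))]
  congr 3
  have h2 : 1 + Complex.I / (4 * t) = (4 * t + Complex.I) / (4 * (t : ℂ)) := by field_simp
  have h4 : (4 * (t : ℂ) + Complex.I) ≠ 0 := by
    intro h
    rw [h2, h, zero_div] at hre
    simp at hre
  have h5 : (4 * (t : ℂ) + Complex.I) * (4 * t - Complex.I) = 1 + 16 * (t : ℂ) ^ 2 := by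
    linear_combination -Complex.I_sq
  have h3 : 1 / (4 * -(1 + Complex.I / (4 * t))) =
      -(t * (4 * t - Complex.I)) / (1 + 16 * (t : ℂ) ^ 2) := by
    refine eq_div_of_mul_eq h1 ?_
    rw [h2, ← h5]
    field_simp
  rw [div_eq_mul_one_div _ (4 * -(1 + Complex.I / (4 * t) : ℂ)), h3]
  push_cast
  field_simp
  ring_nf
  simp only [Complex.I_sq, show Complex.I ^ 3 = -Complex.I by rw [pow_succ, Complex.I_sq]; ring]
  have hr : (1 + (t : ℂ) ^ 2 * 16)⁻¹ * (1 + (t : ℂ) ^ 2 * 16) = 1 :=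
    inv_mul_cancel₀ (by rwa [mul_comm])
  linear_combination (16 * Complex.I * x * t * ξ + 4 * Complex.I * x ^ 2 +
    16 * Complex.I * t ^ 2 * ξ ^ 2) * hr

lemma norm_gaussianAmplitude_sq {t : ℝ} (ht : 0 < t) :
    ‖gaussianAmplitude t‖ ^ 2 = (2 * Real.pi) ^ 2 / √(1 + 16 * t ^ 2) := by
  have h1 : ‖Complex.exp (Complex.I * Real.pi / 4)‖ = 1 := by
    rw [show Complex.I * Real.pi / 4 = ((Real.pi / 4 : ℝ) : ℂ) * Complex.I by push_cast; ring,
      Complex.norm_exp_ofReal_mul_I]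
  have h2 : ‖(Real.pi / (1 + Complex.I / (4 * t)) : ℂ) ^ (1 / 2 : ℂ)‖ ^ 2 =
      Real.pi / (√(1 + 16 * t ^ 2) / (4 * t)) := by
    rw [← norm_pow, ← Complex.cpow_mul_nat]
    norm_num
    rw [abs_of_pos Real.pi_pos]
    congr 1
    have ht' : (t : ℂ) ≠ 0 := by exact_mod_cast ht.ne'
    rw [show 1 + Complex.I / (4 * t) = (((4 * t : ℝ) : ℂ) + ((1 : ℝ) : ℂ) * Complex.I) /
      ((4 * t : ℝ) : ℂ) by push_cast; field_simp, norm_div, Complex.norm_add_mul_I,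
      Complex.norm_real, Real.norm_of_nonneg (by positivity)]
    congr 2
    ring
  rw [gaussianAmplitude, norm_mul, norm_mul, norm_mul, h1, mul_pow, h2, Complex.norm_real,
    Complex.norm_real, Real.norm_of_nonneg (by positivity), Real.norm_of_nonneg (by positivity),
    mul_pow, mul_pow, Real.sq_sqrt Real.pi_pos.le, ← Real.rpow_natCast, ← Real.rpow_mul ht.le,
    show -(1 : ℝ) / 2 * (2 : ℕ) = -1 by norm_num, Real.rpow_neg_one]
  field_simp
  ring

lemma norm_gaussianAmplitude_le {t : ℝ} (ht : 0 < t) : ‖gaussianAmplitude t‖ ≤ 2 * Real.pi := by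
  refine le_of_sq_le_sq ?_ (by positivity)
  rw [norm_gaussianAmplitude_sq ht]
  refine div_le_self (by positivity) ?_
  rw [Real.one_le_sqrt]
  nlinarith

lemma pi_le_norm_gaussianAmplitude {t : ℝ} (ht : 0 < t) (ht1 : t ≤ 1 / 4) :
    Real.pi ≤ ‖gaussianAmplitude t‖ := by
  refine le_of_sq_le_sq ?_ (by positivity)
  rw [norm_gaussianAmplitude_sq ht, le_div_iff₀ (by positivity)]
  have : √(1 + 16 * t ^ 2) ≤ 4 := by
    rw [Real.sqrt_le_left (by norm_num)]
    nlinarith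
  nlinarith [sq_nonneg Real.pi]

lemma norm_schrodingerMeanLine_gaussianWave_le {t : ℝ} (ht : 0 < t) (ξ x : ℝ) :
    ‖schrodingerMeanLine (gaussianWave ξ) t x‖ ≤ 2 * Real.pi := by
  rw [schrodingerMeanLine_gaussianWave ht, norm_mul, Complex.exp_add, norm_mul,
    Complex.norm_exp_ofReal_mul_I, mul_one, Complex.norm_exp, Complex.ofReal_re]
  refine (mul_le_of_le_one_right (norm_nonneg _) ?_).trans (norm_gaussianAmplitude_le ht)
  rw [Real.exp_le_one_iff, neg_div]
  have : 0 ≤ (x + 2 * t * ξ) ^ 2 / (1 + 16 * t ^ 2) := by positivity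
  linarith

/-- The average of the `N` Gaussian wave packets with frequencies `θ, D + θ, …, (N - 1) D + θ`. -/
noncomputable def waveSum (N : ℕ) (D θ y : ℝ) : ℂ :=
  (N : ℂ)⁻¹ * ∑ l ∈ Finset.range N, gaussianWave (D * l + θ) y

lemma integrable_waveSum (N : ℕ) (D θ : ℝ) : Integrable (waveSum N D θ) :=
  (integrable_finsetSum _ fun _ _ => integrable_gaussianWave _).const_mul _

lemma integral_norm_waveSum_le (N : ℕ) (D θ : ℝ) : ∫ y, ‖waveSum N D θ y‖ ≤ √Real.pi := by
  rw [← integral_norm_gaussianWave 0]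
  refine integral_mono (integrable_waveSum N D θ).norm (integrable_gaussianWave 0).norm fun y => ?_
  simp only [waveSum, norm_mul, norm_inv, Complex.norm_natCast, norm_gaussianWave]
  rcases Nat.eq_zero_or_pos N with rfl | hN
  · simp only [Nat.cast_zero, inv_zero, zero_mul]
    positivity
  · have hN' : (0 : ℝ) < N := by exact_mod_cast hN
    rw [inv_mul_le_iff₀ hN']
    refine (norm_sum_le _ _).trans (le_of_eq ?_)
    simp [norm_gaussianWave]

lemma integrable_schrodingerKernelLine_mul {t : ℝ} (ht : 0 < t) {f : ℝ → ℂ} (hf : Integrable f)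
    (x : ℝ) : Integrable fun y => schrodingerKernelLine t (x - y) * f y := by
  refine hf.bdd_mul (c := t ^ (-(1 : ℝ) / 2) * √Real.pi) ?_ ?_
  · have : Continuous fun y => schrodingerKernelLine t (x - y) := by
      unfold schrodingerKernelLine
      fun_prop
    exact this.aestronglyMeasurable
  · exact Eventually.of_forall fun y => (norm_schrodingerKernelLine ht _).le

lemma schrodingerMeanLine_waveSum {t : ℝ} (ht : 0 < t) (N : ℕ) (D θ x : ℝ) :
    schrodingerMeanLine (waveSum N D θ) t x = (N : ℂ)⁻¹ *
      ∑ l ∈ Finset.range N, schrodingerMeanLine (gaussianWave (D * l + θ)) t x := by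
  simp only [schrodingerMeanLine]
  rw [← integral_finsetSum _ fun l _ =>
    integrable_schrodingerKernelLine_mul ht (integrable_gaussianWave _) x, ← integral_const_mul]
  congr 1 with y
  rw [waveSum, ← Finset.mul_sum]
  ring

lemma norm_schrodingerMeanLine_waveSum_le {t : ℝ} (ht : 0 < t) (N : ℕ) (D θ x : ℝ) :
    ‖schrodingerMeanLine (waveSum N D θ) t x‖ ≤ 2 * Real.pi := by
  rw [schrodingerMeanLine_waveSum ht, norm_mul, norm_inv, Complex.norm_natCast]
  rcases Nat.eq_zero_or_pos N with rfl | hN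
  · simp only [Nat.cast_zero, inv_zero, zero_mul]
    positivity
  · have hN' : (0 : ℝ) < N := by exact_mod_cast hN
    rw [inv_mul_le_iff₀ hN']
    refine (norm_sum_le _ _).trans ((Finset.sum_le_sum fun l _ =>
      norm_schrodingerMeanLine_gaussianWave_le ht _ _).trans (le_of_eq ?_))
    simp

lemma half_le_cos_of_abs_le_one {a : ℝ} (ha : |a| ≤ 1) : 1 / 2 ≤ Real.cos a := by
  have := Real.one_sub_sq_div_two_le_cos (x := a)
  have h2 : a ^ 2 ≤ 1 := by rw [← sq_abs]; nlinarith [abs_nonneg a]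
  linarith

/-- Constructive interference: if `t D²` is a multiple of `2π` and `D x + 2 t D θ` is within `δ` of
such a multiple, where `N δ ≤ 1/2`, then the `N` wave packets are in phase at `(x, t)`. -/
lemma le_norm_schrodingerMeanLine_waveSum {N : ℕ} (hN : 0 < N) {t D θ x δ A : ℝ} (ht : 0 < t)
    (ht1 : t ≤ 1 / 4) (htA : 4 * t * A ^ 2 ≤ 1 / 2) {m p : ℤ}
    (hm : t * D ^ 2 = m * (2 * Real.pi)) (hp : |D * x + 2 * t * D * θ - p * (2 * Real.pi)| ≤ δ)
    (hδ : N * δ ≤ 1 / 2) (hA : ∀ l < N, |x + 2 * t * (D * l + θ)| ≤ A) :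
    Real.pi / 2 * Real.exp (-A ^ 2) ≤ ‖schrodingerMeanLine (waveSum N D θ) t x‖ := by
  have hN' : (0 : ℝ) < N := by exact_mod_cast hN
  set z : ℕ → ℝ := fun l => x + 2 * t * (D * l + θ) with hz
  set ε : ℝ := D * x + 2 * t * D * θ - p * (2 * Real.pi) with hε
  set τ : ℝ := 1 + 16 * t ^ 2 with hτ
  have hτ1 : 1 ≤ τ := by rw [hτ]; nlinarith
  -- the phases that remain after removal of a common one and of multiples of `2π`
  set α : ℕ → ℝ := fun l => l * ε - 4 * t * (z l) ^ 2 / τ with hα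
  have hterm : ∀ l : ℕ, schrodingerMeanLine (gaussianWave (D * l + θ)) t x =
      gaussianAmplitude t * Complex.exp (((x * θ + t * θ ^ 2 : ℝ) : ℂ) * Complex.I) *
        Complex.exp (((-(z l) ^ 2 / τ : ℝ) : ℂ) + ((α l : ℝ) : ℂ) * Complex.I) := by
    intro l
    have hper : Complex.exp ((((l : ℤ) * p + (l : ℤ) ^ 2 * m : ℤ) : ℂ) * (2 * Real.pi * Complex.I)) = 1 :=
      Complex.exp_int_mul_two_pi_mul_I _
    rw [schrodingerMeanLine_gaussianWave ht, mul_assoc (gaussianAmplitude t), ← Complex.exp_add,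
      ← mul_one (Complex.exp (_ + (_ + _))), ← hper, ← Complex.exp_add]
    congr 2
    have hmC : (t : ℂ) * D ^ 2 = m * (2 * Real.pi) := by exact_mod_cast hm
    simp only [hα, hz, hε, hτ]
    push_cast
    linear_combination (Complex.I * l ^ 2) * hmC
  have hαle : ∀ l < N, |α l| ≤ 1 := by
    intro l hl
    have h1 : |(l : ℝ) * ε| ≤ 1 / 2 := by
      rw [abs_mul, Nat.abs_cast]
      have : (l : ℝ) ≤ N := by exact_mod_cast hl.le
      exact (mul_le_mul this hp (abs_nonneg _) hN'.le).trans hδ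
    have h2 : |4 * t * (z l) ^ 2 / τ| ≤ 1 / 2 := by
      rw [abs_of_nonneg (by positivity)]
      refine (div_le_self (by positivity) hτ1).trans (le_trans ?_ htA)
      have := sq_le_sq' (abs_le.1 (hA l hl)).1 (abs_le.1 (hA l hl)).2
      gcongr
    exact (abs_sub _ _).trans (by linarith)
  have hsum : Real.exp (-A ^ 2) / 2 * N ≤ ‖∑ l ∈ Finset.range N,
      Complex.exp (((-(z l) ^ 2 / τ : ℝ) : ℂ) + ((α l : ℝ) : ℂ) * Complex.I)‖ := by
    refine le_trans ?_ (Complex.re_le_norm _)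
    rw [Complex.re_sum]
    have : ∀ l ∈ Finset.range N, Real.exp (-A ^ 2) / 2 ≤ (Complex.exp
        (((-(z l) ^ 2 / τ : ℝ) : ℂ) + ((α l : ℝ) : ℂ) * Complex.I)).re := by
      intro l hl
      have hl := Finset.mem_range.1 hl
      rw [Complex.exp_add, ← Complex.ofReal_exp, Complex.re_ofReal_mul,
        Complex.exp_ofReal_mul_I_re]
      have h1 := half_le_cos_of_abs_le_one (hαle l hl)
      have h2 : Real.exp (-A ^ 2) ≤ Real.exp (-(z l) ^ 2 / τ) := by
        rw [Real.exp_le_exp, neg_div, neg_le_neg_iff]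
        refine (div_le_self (by positivity) hτ1).trans ?_
        exact sq_le_sq' (abs_le.1 (hA l hl)).1 (abs_le.1 (hA l hl)).2
      rw [div_eq_mul_one_div]
      exact mul_le_mul h2 h1 (by norm_num) (Real.exp_pos _).le
    refine le_trans (le_of_eq ?_) (Finset.sum_le_sum this)
    simp [mul_comm]
  rw [schrodingerMeanLine_waveSum ht, Finset.sum_congr rfl fun l _ => hterm l, ← Finset.mul_sum,
    norm_mul, norm_mul, norm_mul, Complex.norm_exp_ofReal_mul_I, mul_one, norm_inv,
    Complex.norm_natCast, inv_mul_eq_div, le_div_iff₀ hN']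
  calc Real.pi / 2 * Real.exp (-A ^ 2) * N = Real.pi * (Real.exp (-A ^ 2) / 2 * N) := by ring
    _ ≤ _ := mul_le_mul (pi_le_norm_gaussianAmplitude ht ht1) hsum (by positivity) (norm_nonneg _)

/-- Gaussians centred at `1`-separated points have a bounded sum. -/
lemma exists_sum_gaussian_le : ∃ C : ℝ, 0 < C ∧ ∀ (N : ℕ) (D u : ℝ), 1 ≤ D →
    ∑ l ∈ Finset.range N, Real.exp (-(D * l - u) ^ 2 / 4) ≤ C := by
  have hs : Summable fun k : ℤ => Real.exp (-|(k : ℝ)| / 16) := by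
    have h : Summable fun k : ℕ => Real.exp (-(1 / 16 : ℝ)) ^ k :=
      summable_geometric_of_lt_one (Real.exp_pos _).le (Real.exp_lt_one_iff.2 (by norm_num))
    refine Summable.of_nat_of_neg ?_ ?_ <;>
    · refine h.congr fun k => ?_
      rw [← Real.exp_nat_mul]
      congr 1
      simp
      ring
  refine ⟨∑' k : ℤ, Real.exp (-|(k : ℝ)| / 16), hs.tsum_pos (fun _ => (Real.exp_pos _).le) 0
    (Real.exp_pos _), fun N D u hD => ?_⟩
  set l₀ : ℤ := round (u / D) with hl₀
  have hround : |u - D * l₀| ≤ D / 2 := by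
    have := abs_sub_round (u / D)
    have h2 : u - D * l₀ = D * (u / D - round (u / D)) := by rw [hl₀]; field_simp
    rw [h2, abs_mul, abs_of_pos (by linarith)]
    nlinarith
  have hle : ∀ l ∈ Finset.range N, Real.exp (-(D * l - u) ^ 2 / 4) ≤
      Real.exp (-|(((l : ℤ) - l₀ : ℤ) : ℝ)| / 16) := by
    intro l _
    rw [Real.exp_le_exp]
    rcases eq_or_ne ((l : ℤ) - l₀) 0 with h | h
    · rw [h]
      simp only [Int.cast_zero, abs_zero, neg_zero, zero_div]
      have := sq_nonneg (D * l - u)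
      linarith
    · have h1 : (1 : ℝ) ≤ |(((l : ℤ) - l₀ : ℤ) : ℝ)| := by
        exact_mod_cast Int.one_le_abs h
      set a : ℝ := |(((l : ℤ) - l₀ : ℤ) : ℝ)| with ha
      have h2 : D * a ≤ |D * l - u| + D / 2 := by
        have h3 : D * a = |(D * l - u) + (u - D * l₀)| := by
          rw [ha, ← abs_of_pos (by linarith : 0 < D), ← abs_mul, abs_of_pos (by linarith : 0 < D)]
          congr 1
          push_cast
          ring
        rw [h3]
        exact (abs_add_le _ _).trans (by linarith)
      have h4 : a / 2 ≤ |D * l - u| := by nlinarith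
      have h5 : (a / 2) ^ 2 ≤ (D * l - u) ^ 2 := by
        rw [← sq_abs (D * l - u)]
        exact pow_le_pow_left₀ (by linarith) h4 2
      nlinarith
  refine (Finset.sum_le_sum hle).trans ?_
  have hmap := Finset.sum_map (Finset.range N)
    ⟨fun l : ℕ => ((l : ℤ) - l₀), fun a b h => by simpa using h⟩
    (fun k : ℤ => Real.exp (-|(k : ℝ)| / 16))
  exact hmap.symm.le.trans (hs.sum_le_tsum _ fun _ _ => (Real.exp_pos _).le)

lemma fourier_waveSum (N : ℕ) (D θ η : ℝ) :
    𝓕 (waveSum N D θ) η =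
      (N : ℂ)⁻¹ * ∑ l ∈ Finset.range N, 𝓕 (gaussianWave (D * l + θ)) η := by
  simp only [Real.fourier_real_eq, Circle.smul_def, smul_eq_mul]
  rw [← integral_finsetSum _ fun l _ => ?_, ← integral_const_mul]
  · congr 1 with y
    rw [waveSum, ← Finset.mul_sum]
    ring
  · have := (Real.fourierIntegral_convergent_iff η).2 (integrable_gaussianWave (D * l + θ))
    simpa [Circle.smul_def, mul_comm] using this

/-- A weighted `L²` bound for the Fourier transform of a wave sum; as the frequencies are separated,
it gains the factor `1 / N` of orthogonality. -/
lemma exists_integral_fourier_waveSum_le (Λ : ℝ) : ∃ C : ℝ, 0 < C ∧ ∀ (N : ℕ) (D θ ρ : ℝ),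
    0 < N → 1 ≤ D → 1 ≤ ρ → (∀ l < N, |D * l + θ| ≤ Λ * ρ) →
    Integrable (fun η => (1 + (η / ρ) ^ 2) * ‖𝓕 (waveSum N D θ) η‖ ^ 2) ∧
    ∫ η, (1 + (η / ρ) ^ 2) * ‖𝓕 (waveSum N D θ) η‖ ^ 2 ≤ C / N := by
  obtain ⟨C₁, hC₁, hsum⟩ := exists_sum_gaussian_le
  set w : ℝ → ℝ := fun v => (1 + 2 * Λ ^ 2 + 2 * v ^ 2) * Real.exp (-Real.pi ^ 2 * v ^ 2) with hw
  have hwint : Integrable w := by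
    have h0 := integrable_exp_neg_mul_sq (b := Real.pi ^ 2) (by positivity)
    have h2 := integrable_rpow_mul_exp_neg_mul_sq (b := Real.pi ^ 2) (by positivity) (s := 2)
      (by norm_num)
    refine ((h0.const_mul (1 + 2 * Λ ^ 2)).add (h2.const_mul 2)).congr
      (Eventually.of_forall fun v => ?_)
    simp only [hw, Pi.add_apply, Real.rpow_ofNat]
    ring
  have hwpos : 0 ≤ ∫ v, w v := integral_nonneg fun v => by positivity
  refine ⟨Real.pi * C₁ * (∫ v, w v) + 1, by positivity, fun N D θ ρ hN hD hρ hfreq => ?_⟩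
  have hN' : (0 : ℝ) < N := by exact_mod_cast hN
  set G : ℝ → ℝ := fun η => ((N : ℝ)⁻¹) ^ 2 * (Real.pi * C₁) *
    ∑ l ∈ Finset.range N, w (η - (D * l + θ) / (2 * Real.pi)) with hG
  have hGint : Integrable G :=
    (integrable_finsetSum _ fun l _ => hwint.comp_sub_right _).const_mul _
  have hGval : ∫ η, G η = Real.pi * C₁ * (∫ v, w v) / N := by
    rw [hG, integral_const_mul, integral_finsetSum _ fun l _ => hwint.comp_sub_right _]
    simp only [integral_sub_right_eq_self w, Finset.sum_const, Finset.card_range, nsmul_eq_mul]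
    field_simp
  have hbound : ∀ η, (1 + (η / ρ) ^ 2) * ‖𝓕 (waveSum N D θ) η‖ ^ 2 ≤ G η := by
    intro η
    have hnorm : ∀ ξ : ℝ, ‖𝓕 (gaussianWave ξ) η‖ =
        √Real.pi * Real.exp (-(ξ - 2 * Real.pi * η) ^ 2 / 4) := by
      intro ξ
      rw [fourier_gaussianWave, norm_mul, Complex.norm_exp, Complex.ofReal_re,
        Complex.norm_cpow_eq_rpow_re_of_pos Real.pi_pos, Real.sqrt_eq_rpow]
      norm_num
    have h1 : ‖𝓕 (waveSum N D θ) η‖ ≤ (N : ℝ)⁻¹ * (√Real.pi *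
        ∑ l ∈ Finset.range N, Real.exp (-((D * l + θ) - 2 * Real.pi * η) ^ 2 / 4)) := by
      rw [fourier_waveSum, norm_mul, norm_inv, Complex.norm_natCast, Finset.mul_sum]
      gcongr
      exact (norm_sum_le _ _).trans (Finset.sum_le_sum fun l _ => (hnorm _).le)
    have h2 : ∑ l ∈ Finset.range N, Real.exp (-((D * l + θ) - 2 * Real.pi * η) ^ 2 / 4) ≤ C₁ := by
      have := hsum N D (2 * Real.pi * η - θ) hD
      refine le_trans (le_of_eq (Finset.sum_congr rfl fun l _ => ?_)) this
      congr 2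
      ring
    set S := ∑ l ∈ Finset.range N, Real.exp (-((D * l + θ) - 2 * Real.pi * η) ^ 2 / 4) with hS
    have hS0 : 0 ≤ S := Finset.sum_nonneg fun _ _ => (Real.exp_pos _).le
    have h3 : ‖𝓕 (waveSum N D θ) η‖ ^ 2 ≤ ((N : ℝ)⁻¹) ^ 2 * (Real.pi * C₁) * S := by
      refine (pow_le_pow_left₀ (norm_nonneg _) h1 2).trans ?_
      rw [mul_pow, mul_pow, Real.sq_sqrt Real.pi_pos.le, mul_assoc, mul_assoc, sq S]
      gcongr
    calc (1 + (η / ρ) ^ 2) * ‖𝓕 (waveSum N D θ) η‖ ^ 2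
        ≤ (1 + (η / ρ) ^ 2) * (((N : ℝ)⁻¹) ^ 2 * (Real.pi * C₁) * S) := by gcongr
      _ = ((N : ℝ)⁻¹) ^ 2 * (Real.pi * C₁) * ∑ l ∈ Finset.range N, (1 + (η / ρ) ^ 2) *
          Real.exp (-((D * l + θ) - 2 * Real.pi * η) ^ 2 / 4) := by
          rw [← Finset.mul_sum, ← hS]
          ring
      _ ≤ G η := by
          simp only [hG]
          gcongr with l hl
          have hl' := hfreq l (Finset.mem_range.1 hl)
          set c : ℝ := (D * l + θ) / (2 * Real.pi) with hc
          have hc1 : (c / ρ) ^ 2 ≤ Λ ^ 2 := by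
            have hcρ : |c / ρ| ≤ Λ := by
              rw [hc, abs_div, abs_div, abs_of_pos (by linarith : 0 < ρ),
                abs_of_pos (by positivity : 0 < 2 * Real.pi), div_le_iff₀ (by linarith)]
              refine (div_le_self (abs_nonneg _) ?_).trans hl'
              linarith [Real.pi_gt_three]
            rw [← sq_abs]
            exact pow_le_pow_left₀ (abs_nonneg _) hcρ 2
          have hc2 : ((η - c) / ρ) ^ 2 ≤ (η - c) ^ 2 := by
            rw [div_pow]
            exact div_le_self (sq_nonneg _) (one_le_pow₀ hρ)
          have hc3 : (η / ρ) ^ 2 ≤ 2 * ((η - c) / ρ) ^ 2 + 2 * (c / ρ) ^ 2 := by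
            have : η / ρ = (η - c) / ρ + c / ρ := by ring
            rw [this]
            nlinarith [sq_nonneg ((η - c) / ρ - c / ρ)]
          simp only [hw]
          have hexp : -(D * l + θ - 2 * Real.pi * η) ^ 2 / 4 = -Real.pi ^ 2 * (η - c) ^ 2 := by
            rw [hc]
            field_simp
            ring
          rw [hexp]
          exact mul_le_mul_of_nonneg_right (by linarith) (Real.exp_pos _).le
  have hcont : Continuous fun η => 𝓕 (waveSum N D θ) η := by
    simp only [fourier_waveSum, fourier_gaussianWave]
    fun_prop
  have hint : Integrable (fun η => (1 + (η / ρ) ^ 2) * ‖𝓕 (waveSum N D θ) η‖ ^ 2) := by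
    refine hGint.mono' ?_ (Eventually.of_forall fun η => ?_)
    · have : Continuous fun η => (1 + (η / ρ) ^ 2) * ‖𝓕 (waveSum N D θ) η‖ ^ 2 := by fun_prop
      exact this.aestronglyMeasurable
    · rw [Real.norm_of_nonneg (by positivity)]
      exact hbound η
  refine ⟨hint, (integral_mono hint hGint hbound).trans ?_⟩
  rw [hGval]
  gcongr
  linarith

/-! ### Concentrated plane waves on the line -/

/-- A smooth cutoff with support in `[0, 1/4]`. -/
noncomputable def cutoff : ContDiffBump (1 / 8 : ℝ) := ⟨1 / 16, 1 / 8, by norm_num, by norm_num⟩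

lemma cutoff_ne_zero {y : ℝ} (hy : cutoff y ≠ 0) : 0 < y ∧ y < 1 / 4 := by
  have h : y ∈ Function.support cutoff := hy
  rw [cutoff.support_eq, Metric.mem_ball, Real.dist_eq] at h
  have h' : |y - 1 / 8| < 1 / 8 := h
  rw [abs_lt] at h'
  constructor <;> linarith [h'.1, h'.2]

lemma integral_cutoff_pos : 0 < ∫ y, cutoff y := cutoff.integral_pos

/-- The plane wave `e^(-iσ²y)`, cut off to the interval `[0, 1/(4σ)]`. -/
noncomputable def cutWave (σ y : ℝ) : ℂ :=
  Complex.exp (((-(σ ^ 2 * y) : ℝ) : ℂ) * Complex.I) * (cutoff (σ * y) : ℂ)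

lemma contDiff_cutWave (σ : ℝ) : ContDiff ℝ ∞ (cutWave σ) := by
  have h : ContDiff ℝ ∞ fun y : ℝ => cutoff (σ * y) := cutoff.contDiff.comp (by fun_prop)
  have h2 : ContDiff ℝ ∞ fun y : ℝ => ((cutoff (σ * y) : ℝ) : ℂ) :=
    Complex.ofRealCLM.contDiff.comp h
  have h3 : ContDiff ℝ ∞ fun y : ℝ => ((-(σ ^ 2 * y) : ℝ) : ℂ) :=
    Complex.ofRealCLM.contDiff.comp (contDiff_const.mul contDiff_id).neg
  exact ((h3.mul contDiff_const).cexp).mul h2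

lemma norm_cutWave (σ y : ℝ) : ‖cutWave σ y‖ = cutoff (σ * y) := by
  rw [cutWave, norm_mul, Complex.norm_exp_ofReal_mul_I, one_mul, Complex.norm_real,
    Real.norm_of_nonneg cutoff.nonneg]

lemma cutWave_ne_zero {σ y : ℝ} (hσ : 0 < σ) (hy : cutWave σ y ≠ 0) : 0 < y ∧ σ * y < 1 / 4 := by
  have h : cutoff (σ * y) ≠ 0 := by
    intro h
    apply hy
    rw [cutWave, h, Complex.ofReal_zero, mul_zero]
  exact ⟨(pos_iff_pos_of_mul_pos (cutoff_ne_zero h).1).1 hσ, (cutoff_ne_zero h).2⟩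

lemma cutWave_eq_zero {σ y : ℝ} (hσ : 1 ≤ σ) (hy : y ∉ Set.Ioo (0 : ℝ) (1 / 4)) :
    cutWave σ y = 0 := by
  by_contra h
  obtain ⟨h1, h2⟩ := cutWave_ne_zero (by linarith) h
  exact hy ⟨h1, by nlinarith⟩

lemma integrable_cutoff_mul {σ : ℝ} (hσ : σ ≠ 0) : Integrable fun y => cutoff (σ * y) :=
  cutoff.integrable.comp_mul_left' hσ

lemma integrable_cutWave {σ : ℝ} (hσ : σ ≠ 0) : Integrable (cutWave σ) := by
  refine (integrable_cutoff_mul hσ).mono' (contDiff_cutWave σ).continuous.aestronglyMeasurable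
    (Eventually.of_forall fun y => (norm_cutWave σ y).le)

lemma integral_norm_cutWave {σ : ℝ} (hσ : 0 < σ) :
    ∫ y, ‖cutWave σ y‖ = σ⁻¹ * ∫ y, cutoff y := by
  simp only [norm_cutWave]
  rw [Measure.integral_comp_mul_left (fun y => cutoff y) σ, abs_of_pos (inv_pos.2 hσ), smul_eq_mul]

/-- The cut-off wave has frequency `-σ²`, hence arrives at `x` at time `x / (2σ²)`. Its width `1/σ`
makes the arrival visible during a time `σ⁻³`. -/
lemma le_norm_schrodingerMeanLine_cutWave {σ t x : ℝ} (hσ : 1 ≤ σ) (hx : 1 / 2 < x)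
    (htx : x / (2 * σ ^ 2) ≤ t) (ht : t ≤ 1 / σ ^ 2) (hxt : |x / (2 * t) - σ ^ 2| ≤ σ) :
    √Real.pi / 2 * ∫ y, cutoff y ≤ ‖schrodingerMeanLine (cutWave σ) t x‖ := by
  have hσ0 : 0 < σ := by linarith
  have ht0 : 0 < t := lt_of_lt_of_le (by positivity) htx
  set a : ℝ := x / (2 * t) - σ ^ 2 with ha
  set q : ℝ → ℝ := fun y => y * a - y ^ 2 / (4 * t) with hq
  have hint : Integrable fun y => Complex.exp ((q y : ℂ) * Complex.I) * (cutoff (σ * y) : ℂ) := by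
    have h1 : Continuous fun y => cutoff (σ * y) := cutoff.continuous.comp (by fun_prop)
    have hc : Continuous fun y => Complex.exp ((q y : ℂ) * Complex.I) * (cutoff (σ * y) : ℂ) := by
      simp only [hq]
      fun_prop
    refine (integrable_cutoff_mul hσ0.ne').mono' hc.aestronglyMeasurable
      (Eventually.of_forall fun y => ?_)
    rw [norm_mul, Complex.norm_exp_ofReal_mul_I, one_mul, Complex.norm_real,
      Real.norm_of_nonneg cutoff.nonneg]
  have hmean : schrodingerMeanLine (cutWave σ) t x = schrodingerKernelLine t x *
      ∫ y, Complex.exp ((q y : ℂ) * Complex.I) * (cutoff (σ * y) : ℂ) := by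
    rw [schrodingerMeanLine, ← integral_const_mul]
    congr 1 with y
    have ht' : (t : ℂ) ≠ 0 := by exact_mod_cast ht0.ne'
    have hphase : Complex.exp (-Complex.I * (((x - y) ^ 2 / (4 * t) : ℝ) : ℂ)) *
        Complex.exp (((-(σ ^ 2 * y) : ℝ) : ℂ) * Complex.I) =
        Complex.exp (-Complex.I * ((x ^ 2 / (4 * t) : ℝ) : ℂ)) *
          Complex.exp ((q y : ℂ) * Complex.I) := by
      rw [← Complex.exp_add, ← Complex.exp_add]
      congr 1
      simp only [hq, ha]
      push_cast
      field_simp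
      ring
    rw [schrodingerKernelLine, schrodingerKernelLine, cutWave]
    linear_combination (((t ^ (-(1 : ℝ) / 2) : ℝ) : ℂ) * (((Real.sqrt Real.pi : ℝ) : ℂ) *
      Complex.exp (Complex.I * Real.pi / 4)) * (cutoff (σ * y) : ℂ)) * hphase
  have hsupp : ∀ y, cutoff (σ * y) ≠ 0 → |q y| ≤ 1 := by
    intro y hy
    obtain ⟨h1, h2⟩ := cutoff_ne_zero hy
    have hy0 : 0 < y := (pos_iff_pos_of_mul_pos h1).1 hσ0
    have h3 : |y * a| ≤ 1 / 4 := by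
      rw [abs_mul, abs_of_pos hy0]
      nlinarith
    have h4 : |y ^ 2 / (4 * t)| ≤ 1 / 4 := by
      rw [abs_of_nonneg (by positivity), div_le_iff₀ (by positivity)]
      rw [div_le_iff₀ (by positivity)] at htx
      have h5 : (σ * y) ^ 2 ≤ (1 / 4) ^ 2 := pow_le_pow_left₀ h1.le h2.le 2
      have h6 : 0 < σ ^ 2 := by positivity
      have h7 : σ ^ 2 * y ^ 2 ≤ σ ^ 2 * t := by nlinarith
      nlinarith [le_of_mul_le_mul_left h7 h6]
    exact (abs_sub _ _).trans (by linarith)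
  have hre : σ⁻¹ * (∫ y, cutoff y) / 2 ≤
      ‖∫ y, Complex.exp ((q y : ℂ) * Complex.I) * (cutoff (σ * y) : ℂ)‖ := by
    refine le_trans ?_ (Complex.re_le_norm _)
    have h1 : (∫ y, Complex.exp ((q y : ℂ) * Complex.I) * (cutoff (σ * y) : ℂ)).re =
        ∫ y, (Complex.exp ((q y : ℂ) * Complex.I) * (cutoff (σ * y) : ℂ)).re :=
      (integral_re hint).symm
    rw [h1, ← integral_norm_cutWave hσ0, ← integral_div]
    refine integral_mono ((integrable_cutWave hσ0.ne').norm.div_const 2) hint.re fun y => ?_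
    simp only [norm_cutWave]
    rw [mul_comm (Complex.exp _), Complex.re_ofReal_mul, Complex.exp_ofReal_mul_I_re]
    by_cases hy : cutoff (σ * y) = 0
    · rw [hy]
      simp
    · rw [div_eq_mul_one_div]
      exact mul_le_mul_of_nonneg_left (half_le_cos_of_abs_le_one (hsupp y hy)) cutoff.nonneg
  have hamp : σ ≤ t ^ (-(1 : ℝ) / 2) := by
    have h1 : (1 / σ ^ 2) ^ (-(1 : ℝ) / 2) ≤ t ^ (-(1 : ℝ) / 2) :=
      Real.rpow_le_rpow_of_nonpos ht0 ht (by norm_num)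
    refine le_trans (le_of_eq ?_) h1
    rw [one_div, ← Real.rpow_natCast, ← Real.rpow_neg hσ0.le, ← Real.rpow_mul hσ0.le]
    norm_num
  rw [hmean, norm_mul, norm_schrodingerKernelLine ht0]
  have hI := integral_cutoff_pos
  calc √Real.pi / 2 * ∫ y, cutoff y = σ * √Real.pi * (σ⁻¹ * (∫ y, cutoff y) / 2) := by
        field_simp
    _ ≤ _ := by gcongr

/-- Away from the support of a smooth function its evolution decays as `t → 0`: one integration by
parts gains the factor `t`. -/
lemma exists_norm_schrodingerMeanLine_le {H : ℝ → ℂ} (hH : ContDiff ℝ 1 H)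
    (h0 : ∀ y ∉ Set.Ioo (0 : ℝ) (1 / 4), H y = 0) :
    ∃ L : ℝ, 0 ≤ L ∧ ∀ t x : ℝ, 0 < t → 1 / 2 ≤ x → ‖schrodingerMeanLine H t x‖ ≤ L * √t := by
  have hHc : Continuous H := hH.continuous
  have hH'c : Continuous (deriv H) := hH.continuous_deriv le_rfl
  have hHd : ∀ y, HasDerivAt H (deriv H y) y := fun y =>
    (hH.differentiable (by norm_num) y).hasDerivAt
  obtain ⟨M₀, hM₀⟩ := isCompact_Icc.exists_bound_of_continuousOn
    (s := Set.Icc (0 : ℝ) (1 / 4)) hHc.continuousOn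
  obtain ⟨M₁, hM₁⟩ := isCompact_Icc.exists_bound_of_continuousOn
    (s := Set.Icc (0 : ℝ) (1 / 4)) hH'c.continuousOn
  have hM₀0 : 0 ≤ M₀ := (norm_nonneg _).trans (hM₀ 0 (by norm_num))
  have hM₁0 : 0 ≤ M₁ := (norm_nonneg _).trans (hM₁ 0 (by norm_num))
  refine ⟨√Real.pi * (2 * (4 * M₁ + 16 * M₀)), by positivity, fun t x ht hx => ?_⟩
  set v : ℝ → ℂ := fun y => Complex.exp (-Complex.I * (((x - y) ^ 2 / (4 * t) : ℝ) : ℂ)) with hv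
  set v' : ℝ → ℂ := fun y => v y * (Complex.I * ((x - y) / (2 * t) : ℝ)) with hv'
  set W : ℝ → ℂ := fun y => H y * (((2 * t / (x - y) : ℝ) : ℂ) * (-Complex.I)) with hW
  set W' : ℝ → ℂ := fun y => deriv H y * (((2 * t / (x - y) : ℝ) : ℂ) * (-Complex.I)) +
    H y * (((2 * t / (x - y) ^ 2 : ℝ) : ℂ) * (-Complex.I)) with hW'
  have hxy : ∀ y ∈ Set.uIcc (0 : ℝ) (1 / 4), 1 / 4 ≤ x - y := by
    intro y hy
    rw [Set.uIcc_of_le (by norm_num)] at hy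
    linarith [hy.2]
  have hvd : ∀ y ∈ Set.uIcc (0 : ℝ) (1 / 4), HasDerivAt v (v' y) y := by
    intro y _
    have h1 : HasDerivAt (fun y : ℝ => (x - y) ^ 2 / (4 * t)) (-(x - y) / (2 * t)) y := by
      have := (((hasDerivAt_id y).const_sub x).pow 2).div_const (4 * t)
      refine this.congr_deriv ?_
      simp
      field_simp
      ring
    have h2 := (h1.ofReal_comp.const_mul (-Complex.I)).cexp
    refine h2.congr_deriv ?_
    simp only [hv', hv]
    push_cast
    ring
  have hWd : ∀ y ∈ Set.uIcc (0 : ℝ) (1 / 4), HasDerivAt W (W' y) y := by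
    intro y hy
    have hne : x - y ≠ 0 := by linarith [hxy y hy]
    have h1 : HasDerivAt (fun y : ℝ => 2 * t / (x - y)) (2 * t / (x - y) ^ 2) y := by
      have := ((hasDerivAt_id y).const_sub x).fun_inv hne |>.const_mul (2 * t)
      refine (this.congr_deriv ?_)
      simp
      field_simp
    exact (hHd y).mul (h1.ofReal_comp.mul_const (-Complex.I))
  have hvc : Continuous v := by simp only [hv]; fun_prop
  have hv'c : Continuous v' := by simp only [hv']; fun_prop
  have hW'c : ContinuousOn W' (Set.uIcc (0 : ℝ) (1 / 4)) := by
    have h1 : ContinuousOn (fun y : ℝ => 2 * t / (x - y)) (Set.uIcc (0 : ℝ) (1 / 4)) :=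
      ContinuousOn.div (by fun_prop) (by fun_prop) fun y hy => by linarith [hxy y hy]
    have h2 : ContinuousOn (fun y : ℝ => 2 * t / (x - y) ^ 2) (Set.uIcc (0 : ℝ) (1 / 4)) :=
      ContinuousOn.div (by fun_prop) (by fun_prop) fun y hy => by
        have := hxy y hy
        positivity
    have h1' := Complex.continuous_ofReal.comp_continuousOn h1
    have h2' := Complex.continuous_ofReal.comp_continuousOn h2
    exact (hH'c.continuousOn.mul (h1'.mul continuousOn_const)).add
      (hHc.continuousOn.mul (h2'.mul continuousOn_const))
  have hparts := intervalIntegral.integral_mul_deriv_eq_deriv_mul hWd hvd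
    hW'c.intervalIntegrable (hv'c.intervalIntegrable _ _)
  have hb0 : W 0 = 0 := by simp [hW, h0 0 (by simp)]
  have hb1 : W (1 / 4) = 0 := by simp only [hW, h0 (1 / 4) (by simp), zero_mul]
  rw [hb0, hb1, zero_mul, zero_mul, sub_zero, zero_sub] at hparts
  have hWv : ∀ y ∈ Set.uIcc (0 : ℝ) (1 / 4), W y * v' y = v y * H y := by
    intro y hy
    have hne : (x : ℂ) - y ≠ 0 := by
      have : x - y ≠ 0 := by linarith [hxy y hy]
      exact_mod_cast this
    have ht' : (t : ℂ) ≠ 0 := by exact_mod_cast ht.ne'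
    simp only [hW, hv']
    push_cast
    field_simp
    linear_combination (-(H y * v y)) * Complex.I_sq
  have hmean : schrodingerMeanLine H t x =
      ((t ^ (-(1 : ℝ) / 2) : ℝ) : ℂ) *
        (((Real.sqrt Real.pi : ℝ) : ℂ) * Complex.exp (Complex.I * Real.pi / 4)) *
      ∫ y in (0 : ℝ)..(1 / 4), v y * H y := by
    rw [intervalIntegral.integral_of_le (by norm_num), ← integral_const_mul,
      ← integral_indicator measurableSet_Ioc, schrodingerMeanLine]
    congr 1 with y
    by_cases hy : y ∈ Set.Ioc (0 : ℝ) (1 / 4)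
    · rw [Set.indicator_of_mem hy, schrodingerKernelLine]
      ring
    · rw [Set.indicator_of_notMem hy, h0 y fun h => hy (Set.Ioo_subset_Ioc_self h), mul_zero]
  have hbound : ‖∫ y in (0 : ℝ)..(1 / 4), v y * H y‖ ≤ 2 * (4 * M₁ + 16 * M₀) * t := by
    rw [← intervalIntegral.integral_congr hWv, hparts, norm_neg]
    have : ∀ y ∈ Set.uIoc (0 : ℝ) (1 / 4), ‖W' y * v y‖ ≤ 2 * (4 * M₁ + 16 * M₀) * t := by
      intro y hy
      have hy1 := Set.uIoc_subset_uIcc hy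
      have hy2 : y ∈ Set.Icc (0 : ℝ) (1 / 4) := by rwa [Set.uIcc_of_le (by norm_num)] at hy1
      have hxy' := hxy y hy1
      have hvn : ‖v y‖ = 1 := by
        simp only [hv]
        rw [show -Complex.I * (((x - y) ^ 2 / (4 * t) : ℝ) : ℂ) =
          ((-((x - y) ^ 2 / (4 * t)) : ℝ) : ℂ) * Complex.I by push_cast; ring,
          Complex.norm_exp_ofReal_mul_I]
      have e1 : 2 * t / (x - y) ≤ 8 * t := by
        rw [div_le_iff₀ (by linarith)]
        nlinarith
      have e2 : 2 * t / (x - y) ^ 2 ≤ 32 * t := by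
        rw [div_le_iff₀ (by positivity)]
        have : (1 / 4) ^ 2 ≤ (x - y) ^ 2 := pow_le_pow_left₀ (by norm_num) hxy' 2
        nlinarith
      have e1' : 0 ≤ 2 * t / (x - y) := div_nonneg (by linarith) (by linarith)
      rw [norm_mul, hvn, mul_one]
      refine (norm_add_le _ _).trans ?_
      rw [norm_mul, norm_mul, norm_mul, norm_mul, norm_neg, Complex.norm_I, mul_one, mul_one,
        Complex.norm_real, Complex.norm_real, Real.norm_of_nonneg e1',
        Real.norm_of_nonneg (by positivity)]
      calc ‖deriv H y‖ * (2 * t / (x - y)) + ‖H y‖ * (2 * t / (x - y) ^ 2)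
          ≤ M₁ * (8 * t) + M₀ * (32 * t) := by
            have := hM₀ y hy2
            have := hM₁ y hy2
            gcongr
        _ = _ := by ring
    refine (intervalIntegral.norm_integral_le_of_norm_le_const this).trans ?_
    rw [abs_of_nonneg (by norm_num)]
    have : 0 ≤ 2 * (4 * M₁ + 16 * M₀) * t := by positivity
    linarith
  have hphase : ‖Complex.exp (Complex.I * Real.pi / 4)‖ = 1 := by
    rw [show Complex.I * Real.pi / 4 = ((Real.pi / 4 : ℝ) : ℂ) * Complex.I by push_cast; ring,
      Complex.norm_exp_ofReal_mul_I]
  have hrt : t ^ (-(1 : ℝ) / 2) * t = √t := by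
    nth_rewrite 2 [← Real.rpow_one t]
    rw [← Real.rpow_add ht, Real.sqrt_eq_rpow]
    norm_num
  rw [hmean, norm_mul, norm_mul, norm_mul, hphase, Complex.norm_real, Complex.norm_real,
    Real.norm_of_nonneg (by positivity), Real.norm_of_nonneg (by positivity), mul_one]
  calc t ^ (-(1 : ℝ) / 2) * √Real.pi * ‖∫ y in (0 : ℝ)..(1 / 4), v y * H y‖
      ≤ t ^ (-(1 : ℝ) / 2) * √Real.pi * (2 * (4 * M₁ + 16 * M₀) * t) := by gcongr
    _ = √Real.pi * (2 * (4 * M₁ + 16 * M₀)) * (t ^ (-(1 : ℝ) / 2) * t) := by ring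
    _ = _ := by rw [hrt]

/-- The cutoff as a Schwartz function. -/
noncomputable def cutoffSchwartz : 𝓢(ℝ, ℂ) :=
  HasCompactSupport.toSchwartzMap (f := fun y => ((cutoff y : ℝ) : ℂ))
    (cutoff.hasCompactSupport.comp_left Complex.ofReal_zero)
    (Complex.ofRealCLM.contDiff.comp cutoff.contDiff)

lemma fourier_cutWave {σ : ℝ} (hσ : 0 < σ) (η : ℝ) :
    𝓕 (cutWave σ) η = ((σ⁻¹ : ℝ) : ℂ) * 𝓕 cutoffSchwartz ((η + σ ^ 2 / (2 * Real.pi)) / σ) := by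
  rw [SchwartzMap.fourier_coe, Real.fourier_real_eq_integral_exp_smul,
    Real.fourier_real_eq_integral_exp_smul]
  have h := Measure.integral_comp_mul_left (fun y : ℝ => Complex.exp
    (((-2 * Real.pi * y * ((η + σ ^ 2 / (2 * Real.pi)) / σ) : ℝ) : ℂ) * Complex.I) •
      cutoffSchwartz y) σ
  rw [abs_of_pos (inv_pos.2 hσ), Complex.real_smul] at h
  rw [← h]
  congr 1 with y
  rw [cutWave, smul_eq_mul, smul_eq_mul, ← mul_assoc, ← Complex.exp_add]
  congr 2
  have hπ : (Real.pi : ℂ) ≠ 0 := by exact_mod_cast Real.pi_ne_zero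
  have hσ' : (σ : ℂ) ≠ 0 := by exact_mod_cast hσ.ne'
  push_cast
  field_simp
  ring

/-- The energy of a cut-off wave; the gain `1/σ` is the length of its support. -/
lemma exists_integral_fourier_cutWave_le : ∃ C : ℝ, 0 < C ∧ ∀ σ : ℝ, 1 ≤ σ →
    Integrable (fun η => (1 + (η / σ ^ 2) ^ 2) * ‖𝓕 (cutWave σ) η‖ ^ 2) ∧
    ∫ η, (1 + (η / σ ^ 2) ^ 2) * ‖𝓕 (cutWave σ) η‖ ^ 2 ≤ C / σ := by
  set ψ : 𝓢(ℝ, ℂ) := 𝓕 cutoffSchwartz with hψ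
  set w : ℝ → ℝ := fun v => (3 + 2 * v ^ 2) * ‖ψ v‖ ^ 2 with hw
  have hwint : Integrable w := by
    obtain ⟨B, hB⟩ := ψ.decay 0 0
    have hB' : ∀ v, ‖ψ v‖ ≤ B := fun v => by simpa using hB.2 v
    have hi0 : Integrable fun v => ‖ψ v‖ := ψ.integrable.norm
    have hi2 : Integrable fun v => ‖v‖ ^ 2 * ‖ψ v‖ := ψ.integrable_pow_mul volume 2
    refine (((hi0.const_mul 3).add (hi2.const_mul 2)).const_mul B).mono' ?_
      (Eventually.of_forall fun v => ?_)
    · have : Continuous w := by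
        have := ψ.continuous
        simp only [hw]
        fun_prop
      exact this.aestronglyMeasurable
    · rw [Real.norm_of_nonneg (by positivity)]
      simp only [hw, Pi.add_apply, Real.norm_eq_abs, sq_abs]
      have h1 := hB' v
      have h2 : 0 ≤ (3 + 2 * v ^ 2) * ‖ψ v‖ := by positivity
      nlinarith
  have hwpos : 0 ≤ ∫ v, w v := integral_nonneg fun v => by positivity
  refine ⟨(∫ v, w v) + 1, by positivity, fun σ hσ => ?_⟩
  have hσ0 : 0 < σ := by linarith
  set c : ℝ := σ ^ 2 / (2 * Real.pi) with hc
  set G : ℝ → ℝ := fun η => (σ⁻¹) ^ 2 * w ((η + c) / σ) with hG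
  have hGint : Integrable G :=
    ((hwint.comp_div hσ0.ne').comp_add_right c).const_mul _
  have hGval : ∫ η, G η = (∫ v, w v) / σ := by
    rw [hG, integral_const_mul, integral_add_right_eq_self (fun η => w (η / σ)) c,
      Measure.integral_comp_div, abs_of_pos hσ0, smul_eq_mul]
    field_simp
  have hbound : ∀ η, (1 + (η / σ ^ 2) ^ 2) * ‖𝓕 (cutWave σ) η‖ ^ 2 ≤ G η := by
    intro η
    rw [fourier_cutWave hσ0, norm_mul, Complex.norm_real, Real.norm_of_nonneg (by positivity),
      mul_pow]
    simp only [hG, hw]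
    set v : ℝ := (η + c) / σ with hv
    have h1 : η / σ ^ 2 = v / σ - 1 / (2 * Real.pi) := by
      rw [hv, hc]
      field_simp
      ring
    have h2 : (v / σ) ^ 2 ≤ v ^ 2 := by
      rw [div_pow]
      exact div_le_self (sq_nonneg _) (one_le_pow₀ hσ)
    have h3 : (1 / (2 * Real.pi)) ^ 2 ≤ 1 := by
      refine pow_le_one₀ (by positivity) ?_
      rw [div_le_one (by positivity)]
      linarith [Real.pi_gt_three]
    have h4 : 1 + (η / σ ^ 2) ^ 2 ≤ 3 + 2 * v ^ 2 := by
      rw [h1]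
      nlinarith [sq_nonneg (v / σ + 1 / (2 * Real.pi))]
    calc (1 + (η / σ ^ 2) ^ 2) * ((σ⁻¹) ^ 2 * ‖ψ v‖ ^ 2)
        ≤ (3 + 2 * v ^ 2) * ((σ⁻¹) ^ 2 * ‖ψ v‖ ^ 2) := by gcongr
      _ = _ := by ring
  have hint : Integrable (fun η => (1 + (η / σ ^ 2) ^ 2) * ‖𝓕 (cutWave σ) η‖ ^ 2) := by
    refine hGint.mono' ?_ (Eventually.of_forall fun η => ?_)
    · have : Continuous fun η => (1 + (η / σ ^ 2) ^ 2) * ‖𝓕 (cutWave σ) η‖ ^ 2 := by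
        have := ψ.continuous
        simp only [fourier_cutWave hσ0]
        fun_prop
      exact this.aestronglyMeasurable
    · rw [Real.norm_of_nonneg (by positivity)]
      exact hbound η
  refine ⟨hint, (integral_mono hint hGint hbound).trans ?_⟩
  rw [hGval]
  gcongr
  linarith

/-! ### Choice of the time -/

/-- Among any `B ^ d` consecutive integers there is one whose first `d` digits in base `B` are
prescribed. -/
lemma exists_int_digits {B : ℤ} (hB : 1 ≤ B) (v : ℕ → ℤ) (d : ℕ) (m₀ : ℤ) :
    ∃ m : ℤ, m₀ ≤ m ∧ m < m₀ + B ^ d ∧ ∀ j < d, ∃ z : ℤ,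
      0 ≤ m - v j * B ^ j - z * B ^ (j + 1) ∧ m - v j * B ^ j - z * B ^ (j + 1) < B ^ j := by
  induction d generalizing m₀ with
  | zero => exact ⟨m₀, le_rfl, by simp, fun j hj => absurd hj (Nat.not_lt_zero j)⟩
  | succ d ih =>
    obtain ⟨ρ, hρ0, hρ1, hρ⟩ := ih 0
    have hpos : 0 < B ^ (d + 1) := by positivity
    set m₁ : ℤ := ρ + v d * B ^ d with hm₁
    set k : ℤ := (m₁ - m₀) / B ^ (d + 1) with hk
    have hdiv := Int.emod_add_mul_ediv (m₁ - m₀) (B ^ (d + 1))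
    have hr0 := Int.emod_nonneg (m₁ - m₀) hpos.ne'
    have hr1 := Int.emod_lt_of_pos (m₁ - m₀) hpos
    rw [← hk] at hdiv
    refine ⟨m₁ - B ^ (d + 1) * k, by linarith, by linarith, fun j hj => ?_⟩
    rcases Nat.lt_succ_iff_lt_or_eq.1 hj with hj | rfl
    · obtain ⟨z, hz⟩ := hρ j hj
      refine ⟨z + (v d * B ^ (d - (j + 1)) - k * B ^ (d - j)), ?_⟩
      have e1 : B ^ d = B ^ (d - (j + 1)) * B ^ (j + 1) := by
        rw [← pow_add]
        congr 1
        omega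
      have e2 : B ^ (d + 1) = B ^ (d - j) * B ^ (j + 1) := by
        rw [← pow_add]
        congr 1
        omega
      have : m₁ - B ^ (d + 1) * k - v j * B ^ j -
          (z + (v d * B ^ (d - (j + 1)) - k * B ^ (d - j))) * B ^ (j + 1) =
          ρ - v j * B ^ j - z * B ^ (j + 1) := by
        rw [hm₁, e2, e1]
        ring
      rwa [this]
    · refine ⟨-k, ?_⟩
      have : m₁ - B ^ (j + 1) * k - v j * B ^ j - -k * B ^ (j + 1) = ρ := by
        rw [hm₁]
        ring
      rw [this]
      constructor <;> linarith

/-- The width parameter: at scale `N` the data has frequency `σ²` in the first coordinate. -/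
noncomputable def width (d N : ℕ) : ℝ := (N : ℝ) ^ (d + 2)

/-- The spacing of the frequencies in each of the last `d` coordinates. -/
noncomputable def spacing (d N : ℕ) : ℝ := 32 ^ d * (N : ℝ) ^ (2 * d + 3)

/-- The frequency shift in the `j`-th of the last `d` coordinates. It makes the points of
constructive interference at time `2πm / D²` move by `(16N)^(-j-1)` periods from one `m` to the
next. -/
noncomputable def shift (d N : ℕ) (j : ℕ) : ℝ := spacing d N / (2 * (16 * N) ^ (j + 1))

lemma one_le_width {d N : ℕ} (hN : 1 ≤ N) : 1 ≤ width d N :=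
  one_le_pow₀ (by exact_mod_cast hN)

lemma natCast_le_width {d N : ℕ} (hN : 1 ≤ N) : (N : ℝ) ≤ width d N :=
  le_self_pow₀ (by exact_mod_cast hN) (by omega)

lemma sq_natCast_le_width {d N : ℕ} (hN : 1 ≤ N) : (N : ℝ) ^ 2 ≤ width d N :=
  pow_le_pow_right₀ (by exact_mod_cast hN) (by omega)

lemma one_le_spacing {d N : ℕ} (hN : 1 ≤ N) : 1 ≤ spacing d N :=
  one_le_mul_of_one_le_of_one_le (one_le_pow₀ (by norm_num))
    (one_le_pow₀ (by exact_mod_cast hN))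

lemma spacing_mul_natCast (d N : ℕ) : spacing d N * N = 32 ^ d * width d N ^ 2 := by
  rw [spacing, width]
  ring

lemma shift_nonneg (d N j : ℕ) : 0 ≤ shift d N j := by
  unfold shift spacing
  positivity

lemma shift_le {d N j : ℕ} (hN : 1 ≤ N) : shift d N j ≤ spacing d N := by
  have hN' : (1 : ℝ) ≤ N := by exact_mod_cast hN
  have h0 := one_le_spacing (d := d) hN
  refine div_le_self (by linarith) ?_
  have : (1 : ℝ) ≤ (16 * N) ^ (j + 1) := one_le_pow₀ (by linarith)
  linarith

/-- The frequencies in the last coordinates are at most of the order `σ²`. -/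
lemma frequency_le {d N j l : ℕ} (hl : l < N) :
    |spacing d N * l + shift d N j| ≤ 32 ^ d * width d N ^ 2 := by
  have hN : 1 ≤ N := by omega
  have h0 := one_le_spacing (d := d) hN
  rw [← spacing_mul_natCast, abs_of_nonneg (add_nonneg (by positivity) (shift_nonneg _ _ _))]
  have h1 := shift_le (d := d) (j := j) hN
  have h2 : (l : ℝ) + 1 ≤ N := by exact_mod_cast hl
  nlinarith

/-- For every point there is an admissible time: the wave in the first coordinate arrives and the
waves in all other coordinates interfere constructively. -/
lemma exists_focusing_time {d N : ℕ} (hd : 1 ≤ d) (hN : 1 ≤ N) {x : ℝ} (hx : 1 / 2 < x)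
    (hx1 : x < 1) (y : Fin d → ℝ) :
    ∃ (t : ℝ) (m : ℤ), x / (2 * width d N ^ 2) ≤ t ∧ t ≤ 1 / width d N ^ 2 ∧
      |x / (2 * t) - width d N ^ 2| ≤ width d N ∧ t * spacing d N ^ 2 = m * (2 * Real.pi) ∧
      ∀ j : Fin d, ∃ p : ℤ, |spacing d N * y j + 2 * t * spacing d N * shift d N j -
        p * (2 * Real.pi)| ≤ 2 * Real.pi / (16 * N) := by
  have hN' : (1 : ℝ) ≤ N := by exact_mod_cast hN
  have hσ1 := one_le_width (d := d) hN
  have hD1 := one_le_spacing (d := d) hN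
  have hπ := Real.pi_pos
  set σ := width d N with hσ
  set D := spacing d N with hD
  set B : ℝ := 16 * N with hB
  have hB1 : 1 ≤ B := by linarith
  have hσ0 : 0 < σ := by linarith
  have hD0 : 0 < D := by linarith
  have hB0 : 0 < B := by linarith
  set s : ℝ := x * D ^ 2 / (4 * Real.pi * σ ^ 2) with hs
  obtain ⟨m, hm0, hm1, hm⟩ := exists_int_digits (B := 16 * (N : ℤ)) (by omega)
    (fun j => if h : j < d then ⌊-(B * (D * y ⟨j, h⟩ / (2 * Real.pi)))⌋ else 0) d ⌈s⌉
  have hms : s ≤ m := (Int.le_ceil s).trans (by exact_mod_cast hm0)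
  have hms1 : (m : ℝ) ≤ s + B ^ d := by
    have h1 : m + 1 ≤ ⌈s⌉ + (16 * (N : ℤ)) ^ d := hm1
    have h2 : (m : ℝ) + 1 ≤ (⌈s⌉ : ℝ) + B ^ d := by
      rw [hB]
      exact_mod_cast h1
    linarith [Int.ceil_lt_add_one s]
  set t : ℝ := 2 * Real.pi * m / D ^ 2 with ht
  have hts : 2 * Real.pi * s / D ^ 2 = x / (2 * σ ^ 2) := by
    rw [hs]
    field_simp
    ring
  have ht0 : x / (2 * σ ^ 2) ≤ t := by
    rw [← hts, ht]
    gcongr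
  have ht1 : t ≤ x / (2 * σ ^ 2) + 2 * Real.pi * B ^ d / D ^ 2 := by
    rw [← hts, ht, ← add_div, ← mul_add]
    gcongr
  -- the choice of the spacing makes the admissible times dense enough
  have hgap : 8 * Real.pi * σ ^ 3 * B ^ d ≤ D ^ 2 := by
    have e1 : 8 * Real.pi * σ ^ 3 * B ^ d = 8 * Real.pi * 16 ^ d * (N : ℝ) ^ (4 * d + 6) := by
      rw [hσ, hB, width, mul_pow]
      ring
    have e2 : D ^ 2 = 64 ^ d * 16 ^ d * (N : ℝ) ^ (4 * d + 6) := by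
      rw [hD, spacing, ← mul_pow, mul_pow, ← pow_mul, ← pow_mul, mul_comm d 2, pow_mul (32 : ℝ)]
      norm_num
      ring
    rw [e1, e2]
    have h64 : (64 : ℝ) ≤ 64 ^ d := le_self_pow₀ (by norm_num) (by omega)
    have : 8 * Real.pi ≤ 64 ^ d := by linarith [Real.pi_lt_four]
    gcongr
  have hgap' : 2 * Real.pi * B ^ d / D ^ 2 ≤ 1 / (4 * σ ^ 3) := by
    rw [div_le_div_iff₀ (by positivity) (by positivity)]
    linarith
  have htpos : 0 < t := lt_of_lt_of_le (by positivity) ht0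
  have htσ : x ≤ 2 * σ ^ 2 * t := by
    rw [div_le_iff₀ (by positivity)] at ht0
    linarith
  have htσ1 : 2 * σ ^ 2 * t ≤ x + 1 / (2 * σ) := by
    have h1 : 2 * σ ^ 2 * t ≤ 2 * σ ^ 2 * (x / (2 * σ ^ 2) + 1 / (4 * σ ^ 3)) := by
      have := ht1.trans (add_le_add_right hgap' _)
      gcongr
    refine h1.trans (le_of_eq ?_)
    field_simp
    ring
  have hσi : 1 / (2 * σ) ≤ 1 / 2 := by
    rw [div_le_div_iff₀ (by positivity) (by positivity)]
    linarith
  refine ⟨t, m, ht0, ?_, ?_, ?_, fun j => ?_⟩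
  · rw [le_div_iff₀ (by positivity)]
    linarith
  · have e : x / (2 * t) - σ ^ 2 = -((2 * σ ^ 2 * t - x) / (2 * t)) := by
      field_simp
      ring
    rw [e, abs_neg, abs_of_nonneg (div_nonneg (by linarith) (by positivity)),
      div_le_iff₀ (by positivity)]
    have h1 : 1 / (2 * σ) ≤ σ * (2 * t) := by
      rw [div_le_iff₀ (by positivity)]
      nlinarith
    linarith
  · rw [ht]
    field_simp
  · obtain ⟨p, hp0, hp1⟩ := hm j j.2
    simp only [j.2, dif_pos, Fin.eta] at hp0 hp1
    set u : ℝ := B * (D * y j / (2 * Real.pi)) with hu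
    set v : ℤ := ⌊-u⌋ with hv
    refine ⟨p, ?_⟩
    have hv0 : (v : ℝ) ≤ -u := Int.floor_le _
    have hv1 : -u < v + 1 := Int.lt_floor_add_one _
    set r : ℝ := m - v * B ^ (j : ℕ) - p * B ^ ((j : ℕ) + 1) with hr
    have hr0 : 0 ≤ r := by
      rw [hr, hB]
      exact_mod_cast hp0
    have hr1 : r ≤ B ^ (j : ℕ) := by
      rw [hr, hB]
      exact_mod_cast hp1.le
    have hBj : 0 < B ^ (j : ℕ) := by positivity
    have e : D * y j + 2 * t * D * shift d N j - p * (2 * Real.pi) =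
        2 * Real.pi / B * ((u + v) + r / B ^ (j : ℕ)) := by
      rw [hr, hu, shift, ← hD, ← hB, ht]
      field_simp
      ring
    have hrB0 : 0 ≤ r / B ^ (j : ℕ) := by positivity
    have hrB1 : r / B ^ (j : ℕ) ≤ 1 := by rwa [div_le_one hBj]
    rw [e, abs_mul, abs_of_pos (by positivity)]
    refine mul_le_of_le_one_right (by positivity) ?_
    rw [abs_le]
    constructor <;> linarith

/-! ### The building blocks -/

/-- The factors of a building block: a cut-off plane wave in the first coordinate and wave sums in
the other ones. -/
noncomputable def blockFactor (d N : ℕ) : Fin (d + 1) → ℝ → ℂ :=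
  Fin.cons (cutWave (width d N)) fun j : Fin d => waveSum N (spacing d N) (shift d N j)

/-- The building block at scale `N`. -/
noncomputable def block (d N : ℕ) (x : EuclideanSpace ℝ (Fin (d + 1))) : ℂ :=
  ∏ i, blockFactor d N i (x i)

lemma integrable_blockFactor {d N : ℕ} (hN : 1 ≤ N) (i : Fin (d + 1)) :
    Integrable (blockFactor d N i) := by
  refine Fin.cases ?_ (fun j => ?_) i
  · exact integrable_cutWave (by linarith [one_le_width (d := d) hN])
  · exact integrable_waveSum _ _ _

lemma integrable_block {d N : ℕ} (hN : 1 ≤ N) : Integrable (block d N) :=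
  integrable_euclidean_prod (integrable_blockFactor hN)

lemma block_ne_zero {d N : ℕ} (hN : 1 ≤ N) {x : EuclideanSpace ℝ (Fin (d + 1))}
    (hx : block d N x ≠ 0) : 0 < x 0 ∧ N * x 0 < 1 / 4 := by
  have h0 : blockFactor d N 0 (x 0) ≠ 0 := Finset.prod_ne_zero_iff.1 hx 0 (Finset.mem_univ _)
  have h1 := one_le_width (d := d) hN
  obtain ⟨h2, h3⟩ := cutWave_ne_zero (by linarith) h0
  exact ⟨h2, by nlinarith [natCast_le_width (d := d) hN]⟩

lemma integral_norm_block_le {d N : ℕ} (hN : 1 ≤ N) :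
    ∫ x, ‖block d N x‖ ≤ (∫ y, cutoff y) * √Real.pi ^ d / N ^ 2 := by
  have hσ := one_le_width (d := d) hN
  have hN' : (1 : ℝ) ≤ N := by exact_mod_cast hN
  have hI := integral_cutoff_pos
  simp only [block, norm_prod]
  rw [integral_euclidean_prod fun i y => ‖blockFactor d N i y‖, Fin.prod_univ_succ]
  have h0 : ∫ y, ‖blockFactor d N 0 y‖ ≤ (∫ y, cutoff y) / N ^ 2 := by
    refine (integral_norm_cutWave (by linarith)).le.trans ?_
    rw [inv_mul_eq_div]
    have := sq_natCast_le_width (d := d) hN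
    gcongr
  have h1 : ∏ j : Fin d, ∫ y, ‖blockFactor d N j.succ y‖ ≤ √Real.pi ^ d := by
    rw [← Fin.prod_const]
    exact Finset.prod_le_prod (fun _ _ => integral_nonneg fun _ => norm_nonneg _)
      fun j _ => integral_norm_waveSum_le _ _ _
  calc _ ≤ (∫ y, cutoff y) / N ^ 2 * √Real.pi ^ d :=
        mul_le_mul h0 h1 (Finset.prod_nonneg fun _ _ => integral_nonneg fun _ => norm_nonneg _)
          (by positivity)
    _ = _ := by ring

lemma norm_schrodingerMean_block {d N : ℕ} {t : ℝ} (ht : 0 < t)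
    (x : EuclideanSpace ℝ (Fin (d + 1))) :
    ‖schrodingerMean (d + 1) (block d N) t x‖ =
      ‖schrodingerMeanLine (cutWave (width d N)) t (x 0)‖ * ∏ j : Fin d,
        ‖schrodingerMeanLine (waveSum N (spacing d N) (shift d N j)) t (x j.succ)‖ := by
  have h := schrodingerMean_prod ht (blockFactor d N) x
  rw [show schrodingerMean (d + 1) (block d N) t x = _ from h, norm_prod, Fin.prod_univ_succ]
  rfl

lemma exists_norm_schrodingerMean_block_le {d N : ℕ} (hN : 1 ≤ N) :
    ∃ L : ℝ, 0 ≤ L ∧ ∀ (t : ℝ) (x : EuclideanSpace ℝ (Fin (d + 1))), 0 < t → 1 / 2 ≤ x 0 →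
      ‖schrodingerMean (d + 1) (block d N) t x‖ ≤ L * √t := by
  obtain ⟨L, hL0, hL⟩ := exists_norm_schrodingerMeanLine_le
    ((contDiff_cutWave (width d N)).of_le (by norm_num))
    (fun y hy => cutWave_eq_zero (one_le_width hN) hy)
  refine ⟨L * (2 * Real.pi) ^ d, by positivity, fun t x ht hx => ?_⟩
  rw [norm_schrodingerMean_block ht]
  have h1 : ∏ j : Fin d, ‖schrodingerMeanLine (waveSum N (spacing d N) (shift d N j)) t
      (x j.succ)‖ ≤ (2 * Real.pi) ^ d := by
    rw [← Fin.prod_const]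
    exact Finset.prod_le_prod (fun _ _ => norm_nonneg _)
      fun j _ => norm_schrodingerMeanLine_waveSum_le ht _ _ _ _
  calc _ ≤ L * √t * (2 * Real.pi) ^ d :=
        mul_le_mul (hL t (x 0) ht hx) h1 (Finset.prod_nonneg fun _ _ => norm_nonneg _)
          (by positivity)
    _ = _ := by ring

/-- Every building block of large scale is bounded below at every point of a fixed cube, at a
suitable time. -/
lemma exists_le_norm_schrodingerMean_block {d : ℕ} (hd : 1 ≤ d) :
    ∃ (c : ℝ) (N₀ : ℕ), 0 < c ∧ ∀ N : ℕ, 1 ≤ N → N₀ ≤ N →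
      ∀ x : EuclideanSpace ℝ (Fin (d + 1)), 1 / 2 < x 0 → (∀ i, 0 < x i ∧ x i < 1) →
        ∃ t : ℝ, 1 / (4 * width d N ^ 2) ≤ t ∧ t ≤ 1 / width d N ^ 2 ∧
          c ≤ ‖schrodingerMean (d + 1) (block d N) t x‖ := by
  set A : ℝ := 1 + 2 * 32 ^ d with hA
  have hA1 : 1 ≤ A := by
    rw [hA]
    linarith [show (0 : ℝ) ≤ 2 * 32 ^ d by positivity]
  have hI := integral_cutoff_pos
  refine ⟨(√Real.pi / 2 * ∫ y, cutoff y) * (Real.pi / 2 * Real.exp (-A ^ 2)) ^ d,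
    ⌈8 * A ^ 2⌉₊, by positivity, fun N hN hN₀ x hx0 hx => ?_⟩
  have hN' : (1 : ℝ) ≤ N := by exact_mod_cast hN
  have hNA : 8 * A ^ 2 ≤ N := (Nat.le_ceil _).trans (by exact_mod_cast hN₀)
  have hσ1 := one_le_width (d := d) hN
  obtain ⟨t, m, ht0, ht1, hxt, hm, hp⟩ :=
    exists_focusing_time hd hN hx0 (hx 0).2 (fun j => x j.succ)
  have hσ0 : 0 < width d N := by linarith
  have htpos : 0 < t := lt_of_lt_of_le (by positivity) ht0
  have htσ : t * width d N ^ 2 ≤ 1 := by rwa [le_div_iff₀ (by positivity)] at ht1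
  have htN : t * N ≤ 1 := by
    have : (N : ℝ) ≤ width d N ^ 2 :=
      (natCast_le_width hN).trans (le_self_pow₀ hσ1 (by norm_num))
    nlinarith
  have htA : 4 * t * A ^ 2 ≤ 1 / 2 := by nlinarith
  refine ⟨t, le_trans ?_ ht0, ht1, ?_⟩
  · rw [div_le_div_iff₀ (by positivity) (by positivity)]
    nlinarith [sq_nonneg (width d N)]
  rw [norm_schrodingerMean_block htpos]
  refine mul_le_mul (le_norm_schrodingerMeanLine_cutWave hσ1 hx0 ht0 ht1 hxt) ?_ (by positivity)
    (norm_nonneg _)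
  rw [← Fin.prod_const]
  refine Finset.prod_le_prod (fun _ _ => by positivity) fun j _ => ?_
  obtain ⟨p, hp⟩ := hp j
  refine le_norm_schrodingerMeanLine_waveSum (by omega) htpos (by nlinarith) htA hm hp ?_ ?_
  · rw [mul_div_assoc', div_le_iff₀ (by positivity)]
    nlinarith [Real.pi_lt_four]
  · intro l hl
    have h1 := frequency_le (d := d) (j := j) hl
    have h2 : |2 * t * (spacing d N * l + shift d N j)| ≤ 2 * 32 ^ d := by
      rw [abs_mul, abs_of_pos (by positivity : 0 < 2 * t)]
      calc 2 * t * |spacing d N * l + shift d N j| ≤ 2 * t * (32 ^ d * width d N ^ 2) := by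
            gcongr
        _ = 2 * 32 ^ d * (t * width d N ^ 2) := by ring
        _ ≤ 2 * 32 ^ d := mul_le_of_le_one_right (by positivity) htσ
    refine (abs_add_le _ _).trans ?_
    rw [abs_of_pos (hx j.succ).1, hA]
    linarith [(hx j.succ).2]

/-! ### Sobolev norms of the building blocks -/

lemma one_add_sum_le_prod_one_add {ι : Type*} (s : Finset ι) {a : ι → ℝ} (ha : ∀ i, 0 ≤ a i) :
    1 + ∑ i ∈ s, a i ≤ ∏ i ∈ s, (1 + a i) := by
  classical
  induction s using Finset.induction_on with
  | empty => simp
  | insert i s hi ih =>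
    rw [Finset.sum_insert hi, Finset.prod_insert hi]
    have h1 : 0 ≤ ∑ j ∈ s, a j := Finset.sum_nonneg fun j _ => ha j
    nlinarith [ha i]

lemma eLpNorm_two_le_of_sq_le {α : Type*} [MeasurableSpace α] {μ : Measure α} {g : α → ℂ}
    {G : α → ℝ} {a : ℝ} (ha : 0 ≤ a) (hG : Integrable G μ) (hgG : ∀ x, ‖g x‖ ^ 2 ≤ G x)
    (hGa : ∫ x, G x ∂μ ≤ a ^ 2) : eLpNorm g 2 μ ≤ ENNReal.ofReal a := by
  have h1 : ∫⁻ x, ‖g x‖ₑ ^ (2 : ℝ) ∂μ ≤ ENNReal.ofReal a ^ (2 : ℝ) := by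
    calc ∫⁻ x, ‖g x‖ₑ ^ (2 : ℝ) ∂μ ≤ ∫⁻ x, ENNReal.ofReal (G x) ∂μ := by
          refine lintegral_mono fun x => ?_
          rw [ENNReal.rpow_two, ← ofReal_norm, ← ENNReal.ofReal_pow (norm_nonneg _)]
          exact ENNReal.ofReal_le_ofReal (hgG x)
      _ = ENNReal.ofReal (∫ x, G x ∂μ) := (ofReal_integral_eq_lintegral_ofReal hG
          (Eventually.of_forall fun x => (sq_nonneg _).trans (hgG x))).symm
      _ ≤ ENNReal.ofReal (a ^ 2) := ENNReal.ofReal_le_ofReal hGa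
      _ = _ := by rw [ENNReal.rpow_two, ENNReal.ofReal_pow ha]
  rw [eLpNorm_eq_lintegral_rpow_enorm_toReal (by norm_num) (by norm_num)]
  simp only [ENNReal.toReal_ofNat]
  rw [one_div, ENNReal.rpow_inv_le_iff (by norm_num)]
  exact h1

lemma fourier_block (d N : ℕ) (ξ : EuclideanSpace ℝ (Fin (d + 1))) :
    𝓕 (block d N) ξ = ∏ i, 𝓕 (blockFactor d N i) (ξ i) :=
  fourier_euclidean_prod _ _

lemma continuous_fourier_block {d N : ℕ} (hN : 1 ≤ N) : Continuous (𝓕 (block d N)) :=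
  VectorFourier.fourierIntegral_continuous Real.continuous_fourierChar continuous_inner
    (integrable_block hN)

/-- The energy of a building block, with frequencies measured in units of `σ²`. -/
lemma exists_integral_fourier_block_le (d : ℕ) : ∃ C : ℝ, 0 < C ∧ ∀ N : ℕ, 1 ≤ N →
    Integrable (fun ξ => (1 + ‖ξ‖ ^ 2 / (width d N ^ 2) ^ 2) * ‖𝓕 (block d N) ξ‖ ^ 2) ∧
    ∫ ξ, (1 + ‖ξ‖ ^ 2 / (width d N ^ 2) ^ 2) * ‖𝓕 (block d N) ξ‖ ^ 2 ≤
      C / (N : ℝ) ^ (2 * d + 2) := by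
  obtain ⟨C₀, hC₀, h₀⟩ := exists_integral_fourier_cutWave_le
  obtain ⟨C₁, hC₁, h₁⟩ := exists_integral_fourier_waveSum_le (32 ^ d)
  refine ⟨C₀ * C₁ ^ d, by positivity, fun N hN => ?_⟩
  have hN' : (1 : ℝ) ≤ N := by exact_mod_cast hN
  have hσ1 := one_le_width (d := d) hN
  set ρ : ℝ := width d N ^ 2 with hρ
  have hρ1 : 1 ≤ ρ := one_le_pow₀ hσ1
  set w : Fin (d + 1) → ℝ → ℝ := fun i η => (1 + (η / ρ) ^ 2) * ‖𝓕 (blockFactor d N i) η‖ ^ 2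
    with hw
  have hw0 : Integrable (w 0) ∧ ∫ η, w 0 η ≤ C₀ / width d N := h₀ _ hσ1
  have hw1 : ∀ j : Fin d, Integrable (w j.succ) ∧ ∫ η, w j.succ η ≤ C₁ / N := fun j =>
    h₁ N _ _ ρ (by omega) (one_le_spacing hN) hρ1 fun l hl => frequency_le hl
  have hwint : ∀ i, Integrable (w i) := fun i => Fin.cases hw0.1 (fun j => (hw1 j).1) i
  have hwnn : ∀ i, 0 ≤ ∫ η, w i η := fun i => integral_nonneg fun η => by positivity
  have hint := integrable_euclidean_prod hwint
  have hle : ∀ ξ : EuclideanSpace ℝ (Fin (d + 1)),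
      (1 + ‖ξ‖ ^ 2 / ρ ^ 2) * ‖𝓕 (block d N) ξ‖ ^ 2 ≤ ∏ i, w i (ξ i) := by
    intro ξ
    simp only [hw, Finset.prod_mul_distrib, fourier_block, norm_prod, Finset.prod_pow]
    have h1 : 1 + ‖ξ‖ ^ 2 / ρ ^ 2 = 1 + ∑ i, (ξ i / ρ) ^ 2 := by
      rw [EuclideanSpace.norm_sq_eq, Finset.sum_div]
      simp [div_pow]
    rw [h1]
    gcongr
    exact one_add_sum_le_prod_one_add _ fun i => sq_nonneg _
  have hint' : Integrable (fun ξ => (1 + ‖ξ‖ ^ 2 / ρ ^ 2) * ‖𝓕 (block d N) ξ‖ ^ 2) := by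
    refine hint.mono' ?_ (Eventually.of_forall fun ξ => ?_)
    · have := continuous_fourier_block (d := d) hN
      have : Continuous fun ξ => (1 + ‖ξ‖ ^ 2 / ρ ^ 2) * ‖𝓕 (block d N) ξ‖ ^ 2 := by fun_prop
      exact this.aestronglyMeasurable
    · rw [Real.norm_of_nonneg (by positivity)]
      exact hle ξ
  refine ⟨hint', (integral_mono hint' hint hle).trans ?_⟩
  rw [integral_euclidean_prod w, Fin.prod_univ_succ]
  have h2 : ∏ j : Fin d, ∫ η, w j.succ η ≤ (C₁ / N) ^ d := by
    rw [← Fin.prod_const]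
    exact Finset.prod_le_prod (fun j _ => hwnn _) fun j _ => (hw1 j).2
  calc (∫ η, w 0 η) * ∏ j : Fin d, ∫ η, w j.succ η ≤ C₀ / width d N * (C₁ / N) ^ d :=
        mul_le_mul hw0.2 h2 (Finset.prod_nonneg fun j _ => hwnn _) (by positivity)
    _ = _ := by
        rw [width, div_pow, div_mul_div_comm, ← pow_add]
        congr 2
        omega

/-- The `H_s` norm of a building block decays as long as `s < n / (2 (n + 1))`, where `n = d + 1`. -/
lemma exists_eLpNorm_block_le {d : ℕ} {s : ℝ} (hs0 : 0 ≤ s)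
    (hs : s < ((d : ℝ) + 1) / (2 * (d + 2))) : ∃ C κ : ℝ, 0 ≤ C ∧ 0 < κ ∧ ∀ N : ℕ, 1 ≤ N →
    eLpNorm (fun ξ => (((1 + ‖ξ‖ ^ 2) ^ (s / 2) : ℝ) : ℂ) * 𝓕 (block d N) ξ) 2 ≤
      ENNReal.ofReal (C * (N : ℝ) ^ (-κ)) := by
  obtain ⟨C, hC, h⟩ := exists_integral_fourier_block_le d
  have hs1 : s ≤ 1 := by
    refine hs.le.trans ?_
    rw [div_le_one (by positivity)]
    linarith
  refine ⟨√C, (d + 1) - (2 * d + 4) * s, Real.sqrt_nonneg _, ?_, fun N hN => ?_⟩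
  · rw [lt_div_iff₀ (by positivity)] at hs
    linarith
  obtain ⟨hint, hle⟩ := h N hN
  have hN0 : (0 : ℝ) < N := by exact_mod_cast hN
  have hσ1 := one_le_width (d := d) hN
  set ρ : ℝ := width d N ^ 2 with hρ
  have hρ1 : 1 ≤ ρ := one_le_pow₀ hσ1
  have hρ0 : 0 < ρ := by linarith
  refine eLpNorm_two_le_of_sq_le (by positivity) (hint.const_mul ((ρ ^ 2) ^ s)) (fun ξ => ?_) ?_
  · rw [norm_mul, Complex.norm_real, Real.norm_of_nonneg (by positivity), mul_pow, ← mul_assoc]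
    gcongr
    have h1 : ((1 + ‖ξ‖ ^ 2) ^ (s / 2)) ^ 2 = (1 + ‖ξ‖ ^ 2) ^ s := by
      rw [← Real.rpow_natCast, ← Real.rpow_mul (by positivity)]
      congr 1
      push_cast
      ring
    have h2 : 1 + ‖ξ‖ ^ 2 ≤ ρ ^ 2 * (1 + ‖ξ‖ ^ 2 / ρ ^ 2) := by
      have h3 : 1 ≤ ρ ^ 2 := one_le_pow₀ hρ1
      rw [mul_add, mul_div_cancel₀ _ (by positivity)]
      linarith
    rw [h1]
    calc (1 + ‖ξ‖ ^ 2) ^ s ≤ (ρ ^ 2 * (1 + ‖ξ‖ ^ 2 / ρ ^ 2)) ^ s :=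
          Real.rpow_le_rpow (by positivity) h2 hs0
      _ = (ρ ^ 2) ^ s * (1 + ‖ξ‖ ^ 2 / ρ ^ 2) ^ s := Real.mul_rpow (by positivity) (by positivity)
      _ ≤ (ρ ^ 2) ^ s * (1 + ‖ξ‖ ^ 2 / ρ ^ 2) := by
          gcongr
          refine (Real.rpow_le_rpow_of_exponent_le ?_ hs1).trans_eq (Real.rpow_one _)
          have : 0 ≤ ‖ξ‖ ^ 2 / ρ ^ 2 := by positivity
          linarith
  · rw [integral_const_mul]
    refine (mul_le_mul_of_nonneg_left hle (by positivity)).trans (le_of_eq ?_)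
    rw [mul_pow, Real.sq_sqrt hC.le, hρ, width, ← pow_mul, ← pow_mul, ← Real.rpow_natCast,
      ← Real.rpow_natCast, ← Real.rpow_mul hN0.le, ← Real.rpow_natCast, ← Real.rpow_mul hN0.le,
      div_eq_mul_inv, ← Real.rpow_neg hN0.le, mul_left_comm, ← Real.rpow_add hN0]
    congr 2
    push_cast
    ring

/-! ### Lacunary superposition -/

/-- A sequence growing so fast that each term dominates a given function of all earlier ones. -/
lemma exists_lacunary_seq (Ψ : ℕ → ℝ) (N₀ : ℕ) : ∃ N : ℕ → ℕ, (∀ k, N₀ ≤ N k) ∧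
    (∀ k, 2 ^ k ≤ N k) ∧ ∀ j k, j < k → Ψ (N j) * 2 ^ k ≤ N k := by
  set S : ℕ → ℕ := fun M => ⌈∑ i ∈ Finset.range (M + 1), |Ψ i|⌉₊ with hS
  set N : ℕ → ℕ := fun k => Nat.rec (N₀ + 1) (fun k M => 2 * M + S M * 2 ^ (k + 1)) k with hN
  have hsucc : ∀ k, N (k + 1) = 2 * N k + S (N k) * 2 ^ (k + 1) := fun k => rfl
  have hdouble : ∀ k, 2 * N k ≤ N (k + 1) := fun k => by rw [hsucc]; omega
  have hmono : Monotone N := monotone_nat_of_le_succ fun k => by have := hdouble k; omega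
  refine ⟨N, fun k => ?_, fun k => ?_, fun j k hjk => ?_⟩
  · exact (show N₀ ≤ N 0 from Nat.le_succ N₀).trans (hmono (Nat.zero_le k))
  · induction k with
    | zero => exact Nat.succ_le_succ (Nat.zero_le N₀)
    | succ k ih => rw [pow_succ]; have := hdouble k; omega
  · obtain ⟨k, rfl⟩ : ∃ m, k = m + 1 := ⟨k - 1, by omega⟩
    have h1 : Ψ (N j) ≤ S (N k) := by
      refine (le_abs_self _).trans (le_trans ?_ (Nat.le_ceil _))
      exact Finset.single_le_sum (f := fun i => |Ψ i|) (fun i _ => abs_nonneg _)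
        (Finset.mem_range.2 (Nat.lt_succ_of_le (hmono (Nat.le_of_lt_succ hjk))))
    calc Ψ (N j) * 2 ^ (k + 1) ≤ S (N k) * 2 ^ (k + 1) := by gcongr
      _ ≤ (N (k + 1) : ℝ) := by
        rw [hsucc]
        push_cast
        linarith [show (0 : ℝ) ≤ 2 * N k by positivity]

section Superposition

variable {d : ℕ} {N : ℕ → ℕ}

/-- The superposition of the building blocks at the scales `N k`. -/
noncomputable def blockSeries (d : ℕ) (N : ℕ → ℕ) (x : EuclideanSpace ℝ (Fin (d + 1))) : ℂ :=
  ∑' k, block d (N k) x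

lemma one_le_of_two_pow_le (hN : ∀ k, 2 ^ k ≤ N k) (k : ℕ) : 1 ≤ N k :=
  Nat.one_le_two_pow.trans (hN k)

lemma hasSum_block (hN : ∀ k, 2 ^ k ≤ N k) (x : EuclideanSpace ℝ (Fin (d + 1))) :
    HasSum (fun k => block d (N k) x) (blockSeries d N x) := by
  refine Summable.hasSum ?_
  refine summable_of_hasFiniteSupport ?_
  by_cases hx : 0 < x 0
  · obtain ⟨m, hm⟩ := exists_nat_gt (1 / x 0)
    refine (Set.finite_lt_nat m).subset fun k hk => ?_
    by_contra hkm
    have h1 := (block_ne_zero (one_le_of_two_pow_le hN k) hk).2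
    have h2 : m ≤ N k := (not_lt.1 hkm).trans (Nat.lt_two_pow_self.le.trans (hN k))
    have h3 : (m : ℝ) ≤ N k := by exact_mod_cast h2
    rw [div_lt_iff₀ hx] at hm
    nlinarith
  · refine Set.finite_empty.subset fun k hk => hx ?_
    exact (block_ne_zero (one_le_of_two_pow_le hN k) hk).1

lemma summable_inv_of_two_pow_le (hN : ∀ k, 2 ^ k ≤ N k) {κ : ℝ} (hκ : 0 < κ) :
    Summable fun k => (N k : ℝ) ^ (-κ) := by
  have hgeom : Summable fun k : ℕ => ((2 : ℝ) ^ (-κ)) ^ k :=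
    summable_geometric_of_lt_one (by positivity)
      (Real.rpow_lt_one_of_one_lt_of_neg (by norm_num) (by linarith))
  refine hgeom.of_nonneg_of_le (fun k => by positivity) fun k => ?_
  have h1 : (2 : ℝ) ^ k ≤ N k := by exact_mod_cast hN k
  refine (Real.rpow_le_rpow_of_nonpos (by positivity) h1 (by linarith)).trans (le_of_eq ?_)
  rw [← Real.rpow_natCast, ← Real.rpow_natCast, ← Real.rpow_mul (by norm_num),
    ← Real.rpow_mul (by norm_num), mul_comm]

lemma summable_integral_norm_block (hN : ∀ k, 2 ^ k ≤ N k) :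
    Summable fun k => ∫ x, ‖block d (N k) x‖ := by
  refine ((summable_inv_of_two_pow_le hN (κ := 2) (by norm_num)).mul_left
    ((∫ y, cutoff y) * √Real.pi ^ d)).of_nonneg_of_le
    (fun k => integral_nonneg fun _ => norm_nonneg _) fun k => ?_
  refine (integral_norm_block_le (one_le_of_two_pow_le hN k)).trans (le_of_eq ?_)
  rw [Real.rpow_neg (by positivity), div_eq_mul_inv]
  norm_num

lemma integrable_blockSeries (hN : ∀ k, 2 ^ k ≤ N k) : Integrable (blockSeries d N) := by
  have hint : ∀ k, Integrable (block d (N k)) := fun k =>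
    integrable_block (one_le_of_two_pow_le hN k)
  rw [← memLp_one_iff_integrable]
  refine memLp_of_hasSum le_rfl (fun k => (hint k).1) (Eventually.of_forall (hasSum_block hN))
    (fun k => integral_nonneg fun _ => norm_nonneg _) (summable_integral_norm_block (d := d) hN) fun k => ?_
  rw [eLpNorm_one_eq_lintegral_enorm, ofReal_integral_norm_eq_lintegral_enorm (hint k)]

lemma memSobolevL1_blockSeries (hN : ∀ k, 2 ^ k ≤ N k) {s : ℝ}
    (hs : s < ((d : ℝ) + 1) / (2 * (d + 2))) : MemSobolevL1 (d + 1) s (blockSeries d N) := by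
  have hnonneg : ∀ s' : ℝ, 0 ≤ s' → s' < ((d : ℝ) + 1) / (2 * (d + 2)) →
      MemSobolevL1 (d + 1) s' (blockSeries d N) := by
    intro s' hs0 hs'
    obtain ⟨C, κ, hC, hκ, hle⟩ := exists_eLpNorm_block_le hs0 hs'
    refine memSobolevL1_of_memLp_fourier (integrable_blockSeries hN) ?_
    refine memLp_of_hasSum (by norm_num)
      (g := fun k ξ => (((1 + ‖ξ‖ ^ 2) ^ (s' / 2) : ℝ) : ℂ) * 𝓕 (block d (N k)) ξ)
      (a := fun k => C * (N k : ℝ) ^ (-κ)) (fun k => ?_) (Eventually.of_forall fun ξ => ?_)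
      (fun k => by positivity) ((summable_inv_of_two_pow_le hN hκ).mul_left C)
      fun k => hle _ (one_le_of_two_pow_le hN k)
    · have h1 := continuous_fourier_block (d := d) (one_le_of_two_pow_le hN k)
      have h2 : Continuous fun ξ : EuclideanSpace ℝ (Fin (d + 1)) =>
          (((1 + ‖ξ‖ ^ 2) ^ (s' / 2) : ℝ) : ℂ) :=
        Complex.continuous_ofReal.comp (Continuous.rpow_const (by fun_prop)
          fun ξ => Or.inl (by positivity))
      exact (h2.mul h1).aestronglyMeasurable
    · exact (fourier_hasSum (fun k => integrable_block (one_le_of_two_pow_le hN k))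
        (summable_integral_norm_block hN) ξ).mul_left _
  rcases le_total 0 s with h | h
  · exact hnonneg s h hs
  · obtain ⟨hf, hmem⟩ := hnonneg 0 le_rfl (by positivity)
    exact ⟨hf, hmem.mono h⟩

lemma tsupport_blockSeries_subset (hN : ∀ k, 2 ^ k ≤ N k) :
    tsupport (blockSeries d N) ⊆ {x | x 0 ≤ 1 / 4} := by
  refine closure_minimal (fun x hx => ?_) (isClosed_le (by fun_prop) continuous_const)
  obtain ⟨k, hk⟩ : ∃ k, block d (N k) x ≠ 0 := by
    by_contra! h
    exact hx (by simp [blockSeries, h])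
  obtain ⟨h1, h2⟩ := block_ne_zero (one_le_of_two_pow_le hN k) hk
  have h3 : (1 : ℝ) ≤ N k := by exact_mod_cast one_le_of_two_pow_le hN k
  simp only [Set.mem_ofPred_eq]
  nlinarith

end Superposition

/-- A superposition of building blocks at rapidly increasing scales is bounded below along a
sequence of times, at every point of the cube: at the time at which one block is large, the
contribution of the smoother blocks is small since the point is off their support, and that of the
rougher ones is small by the dispersive estimate. -/
lemma exists_blockSeries_le_norm_schrodingerMean {d : ℕ} (hd : 1 ≤ d) :
    ∃ (N : ℕ → ℕ) (c : ℝ), 0 < c ∧ (∀ k, 2 ^ k ≤ N k) ∧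
      ∀ x : EuclideanSpace ℝ (Fin (d + 1)), 1 / 2 < x 0 → (∀ i, 0 < x i ∧ x i < 1) →
        ∃ t : ℕ → ℝ, (∀ k, 0 < t k) ∧ Tendsto t atTop (𝓝 0) ∧
          ∀ k, c ≤ ‖schrodingerMean (d + 1) (blockSeries d N) (t k) x‖ := by
  obtain ⟨c, N₀, hc, hlow⟩ := exists_le_norm_schrodingerMean_block hd
  have hLex : ∀ M : ℕ, ∃ L : ℝ, 0 ≤ L ∧ (1 ≤ M → ∀ (t : ℝ) (x : EuclideanSpace ℝ (Fin (d + 1))),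
      0 < t → 1 / 2 ≤ x 0 → ‖schrodingerMean (d + 1) (block d M) t x‖ ≤ L * √t) := by
    intro M
    by_cases hM : 1 ≤ M
    · obtain ⟨L, h0, h⟩ := exists_norm_schrodingerMean_block_le (d := d) hM
      exact ⟨L, h0, fun _ => h⟩
    · exact ⟨0, le_rfl, fun h => absurd h hM⟩
  choose L hL0 hL using hLex
  set I : ℝ := (∫ y, cutoff y) * √Real.pi ^ d with hI
  have hI0 : 0 < I := mul_pos integral_cutoff_pos (by positivity)
  set U : ℕ → ℝ := fun M => (2 * width d M * √Real.pi) ^ (d + 1) * I with hU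
  have hU0 : ∀ M, 0 ≤ U M := fun M => by
    simp only [hU, width]
    positivity
  obtain ⟨N, hN₀, hN, hΨ⟩ := exists_lacunary_seq (fun M => 8 / c * (L M + U M)) N₀
  have hN1 := one_le_of_two_pow_le hN
  refine ⟨N, c / 2, by positivity, hN, fun x hx0 hx => ?_⟩
  choose t ht0 ht1 htc using fun k => hlow (N k) (hN1 k) (hN₀ k) x hx0 hx
  have hσ : ∀ k, 1 ≤ width d (N k) := fun k => one_le_width (hN1 k)
  have htpos : ∀ k, 0 < t k := fun k =>
    lt_of_lt_of_le (by have := hσ k; positivity) (ht0 k)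
  have hNpos : ∀ k, (0 : ℝ) < N k := fun k => by exact_mod_cast hN1 k
  have hsqrt : ∀ k, √(t k) ≤ 1 / N k := by
    intro k
    have h1 := natCast_le_width (d := d) (hN1 k)
    have h2 := hσ k
    rw [Real.sqrt_le_left (by have := hNpos k; positivity), div_pow, one_pow]
    refine (ht1 k).trans ?_
    have := hNpos k
    gcongr
  refine ⟨t, htpos, ?_, fun k => ?_⟩
  · refine squeeze_zero (fun k => (htpos k).le) (g := fun k : ℕ => (1 / 2 : ℝ) ^ k) (fun k => ?_)
      (tendsto_pow_atTop_nhds_zero_of_lt_one (by norm_num) (by norm_num))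
    have h1 : (2 : ℝ) ^ k ≤ width d (N k) ^ 2 := by
      have h2 : (2 : ℝ) ^ k ≤ N k := by exact_mod_cast hN k
      exact (h2.trans (natCast_le_width (hN1 k))).trans (le_self_pow₀ (hσ k) (by norm_num))
    refine (ht1 k).trans ?_
    rw [div_pow, one_pow]
    gcongr
  have hsum : HasSum (fun j => schrodingerMean (d + 1) (block d (N j)) (t k) x)
      (schrodingerMean (d + 1) (blockSeries d N) (t k) x) :=
    schrodingerMean_hasSum (htpos k) (fun j => integrable_block (hN1 j))
      (summable_integral_norm_block hN) x
  have hother : ∀ j, j ≠ k →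
      ‖schrodingerMean (d + 1) (block d (N j)) (t k) x‖ ≤ c / 8 * (1 / 2) ^ j := by
    intro j hjk
    rcases lt_or_gt_of_ne hjk with h | h
    · have h1 := hΨ j k h
      have h2 : L (N j) * 2 ^ k ≤ c / 8 * N k := by
        have h3 : 8 / c * L (N j) * 2 ^ k ≤ N k := by
          refine le_trans ?_ h1
          have := hU0 (N j)
          gcongr
          linarith
        calc L (N j) * 2 ^ k = c / 8 * (8 / c * L (N j) * 2 ^ k) := by field_simp
          _ ≤ _ := by gcongr
      calc ‖schrodingerMean (d + 1) (block d (N j)) (t k) x‖ ≤ L (N j) * √(t k) :=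
            hL _ (hN1 j) _ _ (htpos k) hx0.le
        _ ≤ L (N j) * (1 / N k) := mul_le_mul_of_nonneg_left (hsqrt k) (hL0 _)
        _ ≤ c / 8 * (1 / 2) ^ k := by
            have := hNpos k
            rw [mul_one_div, div_le_iff₀ this, div_pow, one_pow]
            have h4 : (0 : ℝ) < 2 ^ k := by positivity
            rw [mul_one_div, div_mul_eq_mul_div, le_div_iff₀ h4]
            exact h2
        _ ≤ c / 8 * (1 / 2) ^ j := by
            have := pow_le_pow_of_le_one (by norm_num : (0 : ℝ) ≤ 1 / 2) (by norm_num) h.le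
            gcongr
    · have h1 := hΨ k j h
      have h2 : U (N k) * 2 ^ j ≤ c / 8 * N j := by
        have h3 : 8 / c * U (N k) * 2 ^ j ≤ N j := by
          refine le_trans ?_ h1
          have := hL0 (N k)
          gcongr
          linarith
        calc U (N k) * 2 ^ j = c / 8 * (8 / c * U (N k) * 2 ^ j) := by field_simp
          _ ≤ _ := by gcongr
      have hamp : (t k) ^ (-(1 : ℝ) / 2) ≤ 2 * width d (N k) := by
        have hσ0 : 0 < width d (N k) := by linarith [hσ k]
        refine (Real.rpow_le_rpow_of_nonpos (by positivity) (ht0 k) (by norm_num)).trans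
          (le_of_eq ?_)
        rw [show 4 * width d (N k) ^ 2 = (2 * width d (N k)) ^ (2 : ℕ) by ring, one_div,
          ← Real.rpow_natCast, ← Real.rpow_neg (by positivity), ← Real.rpow_mul (by positivity)]
        norm_num
      calc ‖schrodingerMean (d + 1) (block d (N j)) (t k) x‖
          ≤ ((t k) ^ (-(1 : ℝ) / 2) * √Real.pi) ^ (d + 1) * ∫ y, ‖block d (N j) y‖ :=
            norm_schrodingerMean_le (htpos k) _ _
        _ ≤ (2 * width d (N k) * √Real.pi) ^ (d + 1) * (I / N j ^ 2) := by
            have h3 := htpos k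
            have h4 := hσ k
            exact mul_le_mul (by gcongr) (integral_norm_block_le (hN1 j))
              (integral_nonneg fun _ => norm_nonneg _) (by positivity)
        _ = U (N k) / N j ^ 2 := by simp only [hU]; ring
        _ ≤ U (N k) / N j := by
            have h5 : (1 : ℝ) ≤ N j := by exact_mod_cast hN1 j
            have h6 : (N j : ℝ) ≤ N j ^ 2 := le_self_pow₀ h5 (by norm_num)
            have := hU0 (N k)
            gcongr
        _ ≤ c / 8 * (1 / 2) ^ j := by
            have := hNpos j
            rw [div_le_iff₀ this, div_pow, one_pow]
            have h4 : (0 : ℝ) < 2 ^ j := by positivity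
            rw [mul_one_div, div_mul_eq_mul_div, le_div_iff₀ h4]
            exact h2
  have hrest := hsum.update k 0
  have hrest_le : ‖0 - schrodingerMean (d + 1) (block d (N k)) (t k) x +
      schrodingerMean (d + 1) (blockSeries d N) (t k) x‖ ≤ c / 8 * 2 := by
    rw [← hrest.tsum_eq]
    refine tsum_of_norm_bounded (hasSum_geometric_two.mul_left (c / 8)) fun j => ?_
    by_cases hjk : j = k
    · rw [hjk, Function.update_self, norm_zero]
      positivity
    · rw [Function.update_of_ne hjk]
      exact hother j hjk
  have h1 := htc k
  have h2 := norm_sub_norm_le (schrodingerMean (d + 1) (block d (N k)) (t k) x)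
    (schrodingerMean (d + 1) (block d (N k)) (t k) x -
      schrodingerMean (d + 1) (blockSeries d N) (t k) x)
  rw [sub_sub_cancel] at h2
  have h3 : ‖schrodingerMean (d + 1) (block d (N k)) (t k) x -
      schrodingerMean (d + 1) (blockSeries d N) (t k) x‖ ≤ c / 8 * 2 := by
    rw [← norm_neg]
    refine le_trans (le_of_eq ?_) hrest_le
    congr 1
    ring
  linarith

theorem theorem1 (n : ℕ) (hn : 2 ≤ n) :
    (∃ f : EuclideanSpace ℝ (Fin n) → ℂ,
      (∀ s : ℝ, s < (n : ℝ) / (2 * ((n : ℝ) + 1)) → MemSobolevL1 n s f) ∧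
      ∃ F : Set (EuclideanSpace ℝ (Fin n)),
        MeasurableSet F ∧ 0 < volume F ∧ F ⊆ (tsupport f)ᶜ ∧
        (∃ c₀ : ℝ, 0 < c₀ ∧ ∀ x ∈ F, ∃ t : ℕ → ℝ,
          (∀ j, 0 < t j) ∧ Tendsto t atTop (𝓝 0) ∧
          ∀ j, c₀ ≤ ‖schrodingerMean n f (t j) x‖) ∧
        ∀ x ∈ F, ¬ Tendsto (fun t : ℝ => schrodingerMean n f t x) (𝓝[>] 0) (𝓝 0)) ∧
    ∀ s : ℝ, s < (n : ℝ) / (2 * ((n : ℝ) + 1)) → ¬ LocalizationAE n s := by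
  obtain ⟨d, rfl⟩ : ∃ d, n = d + 1 := ⟨n - 1, by omega⟩
  obtain ⟨N, c, hc, hN, hdiv⟩ := exists_blockSeries_le_norm_schrodingerMean (d := d) (by omega)
  set f := blockSeries d N with hf
  have hmem : ∀ s : ℝ, s < ((d + 1 : ℕ) : ℝ) / (2 * (((d + 1 : ℕ) : ℝ) + 1)) →
      MemSobolevL1 (d + 1) s f := by
    intro s hs
    refine memSobolevL1_blockSeries hN (hs.trans_eq ?_)
    push_cast
    congr 1
    ring
  set F : Set (EuclideanSpace ℝ (Fin (d + 1))) :=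
    {x | 1 / 2 < x 0} ∩ ⋂ i, {x | 0 < x i ∧ x i < 1} with hF
  have hFopen : IsOpen F := by
    refine (isOpen_lt continuous_const (by fun_prop)).inter (isOpen_iInter_of_finite fun i => ?_)
    have hi : Continuous fun x : EuclideanSpace ℝ (Fin (d + 1)) => x i := by fun_prop
    exact (isOpen_lt continuous_const hi).inter (isOpen_lt hi continuous_const)
  have hFne : F.Nonempty := by
    refine ⟨WithLp.toLp 2 fun _ => 3 / 4, ?_, Set.mem_iInter.2 fun i => ?_⟩ <;>
      simp only [Set.mem_ofPred_eq] <;> norm_num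
  have hFpos : 0 < volume F := hFopen.measure_pos _ hFne
  have hFsupp : F ⊆ (tsupport f)ᶜ := by
    intro x hx hxs
    have h1 : x 0 ≤ 1 / 4 := tsupport_blockSeries_subset hN hxs
    have h2 : 1 / 2 < x 0 := hx.1
    linarith
  have hseq : ∀ x ∈ F, ∃ t : ℕ → ℝ, (∀ j, 0 < t j) ∧ Tendsto t atTop (𝓝 0) ∧
      ∀ j, c ≤ ‖schrodingerMean (d + 1) f (t j) x‖ := fun x hx =>
    hdiv x hx.1 fun i => Set.mem_iInter.1 hx.2 i
  have hnot : ∀ x ∈ F,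
      ¬ Tendsto (fun t : ℝ => schrodingerMean (d + 1) f t x) (𝓝[>] 0) (𝓝 0) := by
    intro x hx hlim
    obtain ⟨t, ht0, htlim, htc⟩ := hseq x hx
    have h1 : Tendsto t atTop (𝓝[>] 0) :=
      tendsto_nhdsWithin_iff.2 ⟨htlim, Eventually.of_forall ht0⟩
    have h2 := ge_of_tendsto' (hlim.comp h1).norm htc
    rw [norm_zero] at h2
    linarith
  refine ⟨⟨f, hmem, F, hFopen.measurableSet, hFpos, hFsupp, ⟨c, hc, hseq⟩, hnot⟩, fun s hs h => ?_⟩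
  have hae := h f (hmem s hs)
  refine hFpos.ne' (measure_mono_null (fun x hx => ?_) hae)
  exact fun hx' => hnot x hx (hx' (hFsupp hx))
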